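/- **Setting.** Let $f:\mathbb R^d\to\mathbb R$ be $C^4$, $\theta_0\in\mathbb R^d$, and let $S_0=\{x: f(x)\le f(\theta_0)\}$ be compact. Put $f_\star=\min_{S_0}f$ and $g=\nabla f$ (which is then automatically Lipschitz on $S_0$). Let $\beta_1,\beta_2\in[0,1)$ with $\beta_1\le\sqrt{\beta_2}$, let $\epsilon>0$, $0<\delta<T$ and $C_T\in\mathbb R$. For $0<\alpha<\delta$ put $\lambda_a=(1-\beta_a)/\alpha$ $(a=1,2)$, $$\rho=\max\Big\{\alpha,\big(\tfrac{\alpha}{1-\beta_1}\big)^2,\tfrac{\alpha}{1-\beta_2}\Big\},\qquad \eta(t)=\frac{\sqrt{1-\beta_2^{t/\alpha}}}{1-\beta_1^{t/\alpha}},\qquad \varepsilon(t)=\epsilon\sqrt{1-\beta_2^{t/\alpha}},$$ and for $s\ge0$ $$K_\beta(s)=\begin{cases}\frac{2}{\sqrt{2\beta-1}}e^{-s/\alpha}\sinh\big(\sqrt{2\beta-1}\,\tfrac s\alpha\big),&\beta>\frac12,\\ \frac{2s}{\alpha}e^{-s/\alpha},&\beta=\frac12,\\ \frac{2}{\sqrt{1-2\beta}}e^{-s/\alpha}\sin\big(\sqrt{1-2\beta}\,\tfrac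 s\alpha\big),&\beta<\frac12.\end{cases}$$ For a trajectory $\theta$ put $$m(t)=\lambda_1\int_0^tK_{\beta_1}(t-\tau)\,g(\theta(\tau))\,d\tau,\qquad v(t)=\lambda_2\int_0^tK_{\beta_2}(t-\tau)\,\|g(\theta(\tau))\|^2\,d\tau,$$ $$M_1(t)=\int_0^t\lambda_1e^{-\lambda_1(t-\tau)}g(\theta(\tau))\,d\tau,\qquad M_2(t)=\int_0^t\lambda_2e^{-\lambda_2(t-\tau)}\|g(\theta(\tau))\|^2\,d\tau,$$ $$\mu(t)=\frac{\eta(t)}{\sqrt{M_2(t)}+\varepsilon(t)},\qquad \Phi(t)=f(\theta(t))-f_\star,\qquad V(t)=\Phi(t)+\frac{\mu(t)}{2\lambda_1}\|M_1(t)\|^2 .$$ Call $\theta$ *admissible for* $\alpha$ if $\theta\in C^3([0,T];\mathbb R^d)$, $\theta(0)=\theta_0$, $\theta(t)\in S_0$ and $v(t)\ge0$ for all $t\in[0,T]$, $\|\ddot\theta(t)\|\le C_T$ for $t\in[\delta-\alpha,T]$, and $\theta$ solves the inertial Adam dynamics $$\frac\alpha2\ddot\theta(t)+\dot\theta(t)=-\eta(t+\alpha)\,\frac{m(t+\alpha)}{\sqrt{v(t+\alpha)}+\varepsilon(t+\alpha)},\qquad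 0\le t\le T-\alpha .$$ **Theorem.** There are $\alpha_0,c_0,C_0>0$ such that the following holds. All constants below are independent of $\alpha$ and of the trajectory (they may depend on $f,\theta_0,\beta_1,\beta_2,\epsilon,\delta,T,C_T$ and on the data of the respective item), and the estimates hold for every $\alpha\in(0,\alpha_0]$ with $\alpha<\delta$ and every trajectory $\theta$ admissible for $\alpha$. 1. *(Dissipation.)* If $T-\alpha\ge\delta$, then $$V(T-\alpha)-V(\delta)\le-c_0\int_\delta^{T-\alpha}\|M_1(t)\|^2\,dt+C_0\,\rho\,(T-\alpha-\delta),$$ and if $T-\alpha>\delta$, then $$\frac1{T-\alpha-\delta}\int_\delta^{T-\alpha}\|M_1(t)\|^2\,dt\le\frac{V(\delta)}{c_0(T-\alpha-\delta)}+\frac{C_0}{c_0}\rho .$$ 2. *(PL case.)* If for some $\mu_{\rm PL}>0$ one has $\frac12\|g(x)\|^2\ge\mu_{\rm PL}(f(x)-f_\star)$ for all $x\in S_0$, then there are $\omega,C>0$ such that, for $t\in[\delta,T-\alpha]$, $$\Phi(t)\le V(\delta)e^{-\omega(t-\delta)}+C\rho^2 .$$ If moreover $f$ is strongly convex on $S_0$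 with minimizer $\theta^\ast$ (in particular $S_0$ is convex), then there are $C',C''>0$ such that, for $t\in[\delta,T-\alpha]$, $$\|\theta(t)-\theta^\ast\|\le C''e^{-\omega(t-\delta)/2}+C'\rho .$$ 3. *(KL case.)* Let $\sigma\in(0,1)$, and suppose that there are $C_{\rm KL}>0$ and an open neighbourhood $U$ of the set of critical points of $f$ in $S_0$ such that $\|g(x)\|\ge C_{\rm KL}(f(x)-f_\star)^\sigma$ for all $x\in S_0\cap U$. For $k>0$, $y\ge0$ and $s\ge0$ let $$p_{\sigma,k,y}(s)=\begin{cases}\big(\max\{0,\;y^{1-2\sigma}-(1-2\sigma)ks\}\big)^{1/(1-2\sigma)},&\sigma<\frac12,\\ y\,e^{-ks},&\sigma=\frac12,\\ y\,\big(1+(2\sigma-1)k\,y^{2\sigma-1}s\big)^{-1/(2\sigma-1)},&\sigma>\frac12,\end{cases}$$ which solves $p'=-k\,p^{2\sigma}$, $p(0)=y$. Then there are $k,C>0$ such that, for $t\in[\delta,T-\alpha]$, $$\Phi(t)\le p_{\sigma,k,\Phi(\delta)}(t-\delta)+C\rho^{1/(2\sigma)},\qquad p_{\sigma,k,\Phi(\delta)}(t-\delta)\le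 p_{\sigma,k,f(\theta_0)-f_\star}(t-\delta),$$ so that in particular $\Phi(t)\le p_\sigma(t-\delta)+C\rho^{1/(2\sigma)}$ with the $\alpha$-independent rate function $p_\sigma=p_{\sigma,k,f(\theta_0)-f_\star}$. -/

import Mathlib

noncomputable section

namespace InertialAdam

open Set

/-- The causal kernel `K_β` of the second-order moment equations (critical, over- and underdamped
regimes). -/
def kernel (α β s : ℝ) : ℝ :=
  if β = 1 / 2 then 2 * s / α * Real.exp (-s / α)
  else if 1 / 2 < β then
    2 / √(2 * β - 1) * Real.exp (-s / α) * Real.sinh (√(2 * β - 1) / α * s)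
  else
    2 / √(1 - 2 * β) * Real.exp (-s / α) * Real.sin (√(1 - 2 * β) / α * s)

/-- The memory rate `λ = (1 - β) / α`. -/
def rate (α β : ℝ) : ℝ := (1 - β) / α

/-- The first-order memory kernel `H⁽¹⁾(s) = λ e^{-λ s}`, with `λ = (1 - β) / α`. -/
def kernelOne (α β s : ℝ) : ℝ := rate α β * Real.exp (-(rate α β) * s)

/-- The second-order memory kernel `H⁽²⁾(s) = λ K_β(s)`, with `λ = (1 - β) / α`. -/
def kernelTwo (α β s : ℝ) : ℝ := rate α β * kernel α β s

/-- The causal convolution `∫₀ᵗ H(t - τ) φ(τ) dτ`. -/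
def causalConv {F : Type*} [NormedAddCommGroup F] [NormedSpace ℝ F]
    (H : ℝ → ℝ) (φ : ℝ → F) (t : ℝ) : F :=
  ∫ τ in (0 : ℝ)..t, H (t - τ) • φ τ

/-- The first moment `m` of the inertial dynamics. -/
def moment {d : ℕ} (f : EuclideanSpace ℝ (Fin d) → ℝ) (α β₁ : ℝ)
    (θ : ℝ → EuclideanSpace ℝ (Fin d)) (t : ℝ) : EuclideanSpace ℝ (Fin d) :=
  causalConv (kernelTwo α β₁) (fun τ => gradient f (θ τ)) t

/-- The (isotropic, scalar) second moment `v` of the inertial dynamics. -/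
def secondMoment {d : ℕ} (f : EuclideanSpace ℝ (Fin d) → ℝ) (α β₂ : ℝ)
    (θ : ℝ → EuclideanSpace ℝ (Fin d)) (t : ℝ) : ℝ :=
  causalConv (kernelTwo α β₂) (fun τ => ‖gradient f (θ τ)‖ ^ 2) t

/-- `M₁(t) = ∫₀ᵗ λ₁ e^{-λ₁ (t - τ)} ∇f(θ(τ)) dτ`, the solution of
`M₁' + λ₁ M₁ = λ₁ ∇f(θ)`, `M₁(0) = 0`. -/
def momentOne {d : ℕ} (f : EuclideanSpace ℝ (Fin d) → ℝ) (α β₁ : ℝ)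
    (θ : ℝ → EuclideanSpace ℝ (Fin d)) (t : ℝ) : EuclideanSpace ℝ (Fin d) :=
  causalConv (kernelOne α β₁) (fun τ => gradient f (θ τ)) t

/-- `M₂(t) = ∫₀ᵗ λ₂ e^{-λ₂ (t - τ)} ‖∇f(θ(τ))‖² dτ`, the solution of
`M₂' + λ₂ M₂ = λ₂ ‖∇f(θ)‖²`, `M₂(0) = 0`. -/
def secondMomentOne {d : ℕ} (f : EuclideanSpace ℝ (Fin d) → ℝ) (α β₂ : ℝ)
    (θ : ℝ → EuclideanSpace ℝ (Fin d)) (t : ℝ) : ℝ :=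
  causalConv (kernelOne α β₂) (fun τ => ‖gradient f (θ τ)‖ ^ 2) t

/-- The bias-correction factor `η(t)`. -/
def biasEta (α β₁ β₂ t : ℝ) : ℝ := √(1 - β₂ ^ (t / α)) / (1 - β₁ ^ (t / α))

/-- The bias-corrected stabilizer `ε(t)`. -/
def biasEps (α β₂ ε t : ℝ) : ℝ := ε * √(1 - β₂ ^ (t / α))

/-- The inertial Adam dynamics on the horizon `[0, T]`:
`(α/2) θ''(t) + θ'(t) = -η(t+α) m(t+α) / (√v(t+α) + ε(t+α))` for every `t` for which the
shifted time `t + α` lies in `[α, T]`. -/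
def SolvesInertialAdam {d : ℕ} (f : EuclideanSpace ℝ (Fin d) → ℝ) (α β₁ β₂ ε T : ℝ)
    (θ : ℝ → EuclideanSpace ℝ (Fin d)) : Prop :=
  ∀ t ∈ Icc (0 : ℝ) (T - α),
    (α / 2) • iteratedDerivWithin 2 θ (Icc 0 T) t + derivWithin θ (Icc 0 T) t =
      -((biasEta α β₁ β₂ (t + α) /
          (√(secondMoment f α β₂ θ (t + α)) + biasEps α β₂ ε (t + α))) •
        moment f α β₁ θ (t + α))

/-- The sublevel set `S₀ = {x | f x ≤ f x₀}`. -/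
def sublevel {d : ℕ} (f : EuclideanSpace ℝ (Fin d) → ℝ) (x₀ : EuclideanSpace ℝ (Fin d)) :
    Set (EuclideanSpace ℝ (Fin d)) :=
  {x | f x ≤ f x₀}

/-- `f⋆`, the minimum of `f` over the (compact) sublevel set `S₀`. -/
def fStar {d : ℕ} (f : EuclideanSpace ℝ (Fin d) → ℝ) (x₀ : EuclideanSpace ℝ (Fin d)) : ℝ :=
  sInf (f '' sublevel f x₀)

/-- The residual `f x - f⋆`; along a trajectory, `Φ(t) = gap f x₀ (θ t)`. -/
def gap {d : ℕ} (f : EuclideanSpace ℝ (Fin d) → ℝ) (x₀ x : EuclideanSpace ℝ (Fin d)) : ℝ :=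
  f x - fStar f x₀

/-- The effective scalar `μ(t) = η(t) / (√M₂(t) + ε(t))`. -/
def effScalar {d : ℕ} (f : EuclideanSpace ℝ (Fin d) → ℝ) (α β₁ β₂ ε : ℝ)
    (θ : ℝ → EuclideanSpace ℝ (Fin d)) (t : ℝ) : ℝ :=
  biasEta α β₁ β₂ t / (√(secondMomentOne f α β₂ θ t) + biasEps α β₂ ε t)

/-- The Lyapunov functional `V(t) = Φ(t) + μ(t) / (2 λ₁) ‖M₁(t)‖²`. -/
def lyapunov {d : ℕ} (f : EuclideanSpace ℝ (Fin d) → ℝ) (x₀ : EuclideanSpace ℝ (Fin d))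
    (α β₁ β₂ ε : ℝ) (θ : ℝ → EuclideanSpace ℝ (Fin d)) (t : ℝ) : ℝ :=
  gap f x₀ (θ t) +
    effScalar f α β₁ β₂ ε θ t / (2 * rate α β₁) * ‖momentOne f α β₁ θ t‖ ^ 2

/-- The perturbation size `ρ`. -/
def rho (α β₁ β₂ : ℝ) : ℝ := max α (max ((α / (1 - β₁)) ^ 2) (α / (1 - β₂)))

/-- The standing assumptions on a trajectory `θ` with step size `α` on the horizon `[0, T]`.
The acceleration bound `CT` is required only away from the initial time. -/
structure IsAdmissible {d : ℕ} (f : EuclideanSpace ℝ (Fin d) → ℝ)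
    (x₀ : EuclideanSpace ℝ (Fin d)) (β₁ β₂ ε δ T CT α : ℝ)
    (θ : ℝ → EuclideanSpace ℝ (Fin d)) : Prop where
  start : θ 0 = x₀
  smooth : ContDiffOn ℝ 3 θ (Icc 0 T)
  solves : SolvesInertialAdam f α β₁ β₂ ε T θ
  mem_sublevel : ∀ t ∈ Icc (0 : ℝ) T, θ t ∈ sublevel f x₀
  secondMoment_nonneg : ∀ t ∈ Icc (0 : ℝ) T, 0 ≤ secondMoment f α β₂ θ t
  acc_bound : ∀ t ∈ Icc (δ - α) T, ‖iteratedDerivWithin 2 θ (Icc 0 T) t‖ ≤ CT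

/-- The Polyak-Łojasiewicz inequality on `S₀` with constant `μ`. -/
def PLInequality {d : ℕ} (f : EuclideanSpace ℝ (Fin d) → ℝ) (x₀ : EuclideanSpace ℝ (Fin d))
    (μ : ℝ) : Prop :=
  ∀ x ∈ sublevel f x₀, μ * gap f x₀ x ≤ 1 / 2 * ‖gradient f x‖ ^ 2

/-- The Kurdyka-Łojasiewicz inequality on `S₀` with exponent `σ`: for some constant `c > 0` it
holds at the points of `S₀` in a neighbourhood `U` of the critical points of `f` in `S₀`. -/
def KLInequality {d : ℕ} (f : EuclideanSpace ℝ (Fin d) → ℝ) (x₀ : EuclideanSpace ℝ (Fin d))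
    (σ : ℝ) : Prop :=
  ∃ c > 0, ∃ U : Set (EuclideanSpace ℝ (Fin d)), IsOpen U ∧
    {x | x ∈ sublevel f x₀ ∧ gradient f x = 0} ⊆ U ∧
    ∀ x ∈ sublevel f x₀ ∩ U, c * gap f x₀ x ^ σ ≤ ‖gradient f x‖

/-- The Kurdyka-Łojasiewicz rate function: the solution `p : [0, ∞) → [0, ∞)` of
`p' = -k p^{2σ}`, `p(0) = y` (for `σ < 1/2`, the one that stays at `0` once it has reached it).
It vanishes in finite time if `σ < 1/2`, decays exponentially if `σ = 1/2`, and like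
`s ^ (-1 / (2σ - 1))` if `σ > 1/2`. -/
def klRate (σ k y s : ℝ) : ℝ :=
  if σ < 1 / 2 then (max 0 (y ^ (1 - 2 * σ) - (1 - 2 * σ) * k * s)) ^ (1 / (1 - 2 * σ))
  else if σ = 1 / 2 then y * Real.exp (-k * s)
  else y * (1 + (2 * σ - 1) * k * y ^ (2 * σ - 1) * s) ^ (-1 / (2 * σ - 1))

end InertialAdam

end

noncomputable section

namespace InertialAdam

open Set MeasureTheory

/-! Past the initial layer `[0, δ]`, inertial Adam is a preconditioned gradient flow with an error
of order `α`. Each memory kernel has unit mass and lives on the time scale `α`, so averaging a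
signal against it returns the signal up to `O(α)` plus a transient that has died out by time `δ`.
The proof of this integrates by parts against the tail of the kernel, and so needs the velocity only
up to a spike of size `1/α` and width `α` at time zero (`norm_causalConv_sub_le_of_le`). The
dynamics allow no worse spike, because the forcing is bounded and the trajectory stays in the
compact `S₀` (`norm_velocity_le`). `exists_isControlled` collects the resulting bounds, uniform in
`α` and in the trajectory.

With `m(t+α) = ∇f(θ(t)) + O(α)`, a scalar prefactor between two positive constants, and `(α/2)θ'' =
O(α)`, Young's inequality gives `Φ' ≤ -κ‖∇f‖² + Cα²` (`exists_inner_gradient_le`). The PL and KL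
items are scalar comparison arguments applied to this inequality; KL is first extended from a
neighbourhood of the critical points to all of `S₀` by compactness.

The kinetic term of `V` carries the factor `1/(2λ₁) = O(α)`, so it suffices to bound the growth of
`μ‖M₁‖²` by a multiple of elapsed time, uniformly in `α`. Both moments are uniformly Lipschitz past
`δ`; the obstacle is `√M₂`, which is not Lipschitz at zero. The condition `β₁ ≤ √β₂` removes it by
giving `‖M₁‖² ≤ Q M₂` (`norm_sq_momentOne_le`), so the numerator vanishes wherever the square root
degenerates (`div_sqrt_add_sub_le`). -/

/-! ### Memory kernels: unit mass, exponential decay of kernel and tail. -/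

/-- `H` is a memory kernel of amplitude `C` and decay rate `c / α`: it has unit mass, and both `H`
and its tail `E` decay exponentially. -/
def IsMemoryKernel (C c α : ℝ) (H : ℝ → ℝ) : Prop :=
  Continuous H ∧ (∀ s, 0 ≤ s → |H s| ≤ C / α * Real.exp (-(c / α) * s)) ∧
    ∃ E : ℝ → ℝ, E 0 = 1 ∧ (∀ s, HasDerivAt E (-H s) s) ∧
      ∀ s, 0 ≤ s → |E s| ≤ C * Real.exp (-(c / α) * s)

theorem IsMemoryKernel.mono {C c C' c' α : ℝ} {H : ℝ → ℝ} (h : IsMemoryKernel C c α H)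
    (hα : 0 < α) (hC0 : 0 ≤ C) (hC : C ≤ C') (hc : c' ≤ c) : IsMemoryKernel C' c' α H := by
  obtain ⟨h1, h2, E, h3, h4, h5⟩ := h
  have key : ∀ s, 0 ≤ s → Real.exp (-(c / α) * s) ≤ Real.exp (-(c' / α) * s) := by
    intro s hs
    have : c' / α * s ≤ c / α * s := by gcongr
    apply Real.exp_le_exp.2
    linarith
  refine ⟨h1, fun s hs => (h2 s hs).trans ?_, E, h3, h4, fun s hs => (h5 s hs).trans ?_⟩
  · have := key s hs
    have : 0 ≤ C' := hC0.trans hC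
    gcongr
  · have := key s hs
    have : 0 ≤ C' := hC0.trans hC
    gcongr

theorem rate_pos {α β : ℝ} (hα : 0 < α) (hβ : β < 1) : 0 < rate α β :=
  div_pos (by linarith) hα

theorem isMemoryKernel_kernelOne {α β : ℝ} (hα : 0 < α) (hβ0 : 0 ≤ β) (hβ : β < 1) :
    IsMemoryKernel 1 (1 - β) α (kernelOne α β) := by
  have hr := rate_pos hα hβ
  refine ⟨by unfold kernelOne; fun_prop, fun s _ => ?_, fun s => Real.exp (-(rate α β) * s),
    by simp, fun s => ?_, fun s _ => ?_⟩
  · unfold kernelOne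
    rw [abs_mul, abs_of_pos hr, Real.abs_exp]
    unfold rate
    gcongr
    linarith
  · have := ((hasDerivAt_id s).const_mul (-(rate α β))).exp
    refine this.congr_deriv ?_
    simp [kernelOne]
    ring
  · rw [Real.abs_exp, one_mul, rate]

/-- The rescaled kernel `u ↦ K_β (α u)` solves `P''/2 + P' + (1 - β) P = 0`, `P(0) = 0`,
`P'(0) = 2`, and decays exponentially. -/
theorem exists_scaled_kernel {β : ℝ} (hβ : β < 1) :
    ∃ C > 0, ∃ c > 0, ∃ P P' : ℝ → ℝ, P 0 = 0 ∧ P' 0 = 2 ∧ (∀ u, HasDerivAt P (P' u) u) ∧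
      (∀ u, HasDerivAt P' (-2 * P' u - 2 * (1 - β) * P u) u) ∧
      (∀ u, 0 ≤ u → |P u| ≤ C * Real.exp (-c * u)) ∧
      (∀ u, 0 ≤ u → |P' u| ≤ C * Real.exp (-c * u)) ∧
      ∀ α s, kernel α β s = P (s / α) := by
  have hexp : ∀ u : ℝ, HasDerivAt (fun u : ℝ => Real.exp (-u)) (-Real.exp (-u)) u := fun u =>
    (hasDerivAt_neg u).exp.congr_deriv (by ring)
  rcases lt_trichotomy β (1 / 2) with h | h | h
  · set w := √(1 - 2 * β) with hw
    have hw0 : 0 < w := Real.sqrt_pos.2 (by linarith)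
    have hw2 : w ^ 2 = 1 - 2 * β := Real.sq_sqrt (by linarith)
    have hlin : ∀ u : ℝ, HasDerivAt (fun u : ℝ => w * u) w u := fun u => by
      simpa using (hasDerivAt_id u).const_mul w
    have hP : ∀ u, HasDerivAt (fun u => 2 / w * (Real.exp (-u) * Real.sin (w * u)))
        (-(2 / w * (Real.exp (-u) * Real.sin (w * u))) +
          2 * (Real.exp (-u) * Real.cos (w * u))) u := fun u => by
      refine (((hexp u).mul (hlin u).sin).const_mul (2 / w)).congr_deriv ?_
      field_simp
    have hb : ∀ u, |2 / w * (Real.exp (-u) * Real.sin (w * u))| ≤ 2 / w * Real.exp (-u) := by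
      intro u
      rw [abs_mul, abs_mul, Real.abs_exp, abs_of_pos (by positivity : 0 < 2 / w)]
      have := Real.abs_sin_le_one (w * u)
      gcongr
      exact mul_le_of_le_one_right (Real.exp_pos _).le this
    refine ⟨2 / w + 2, by positivity, 1, one_pos,
      fun u => 2 / w * (Real.exp (-u) * Real.sin (w * u)), fun u =>
        -(2 / w * (Real.exp (-u) * Real.sin (w * u))) + 2 * (Real.exp (-u) * Real.cos (w * u)),
      by simp, by simp, hP, fun u => ?_, fun u _ => ?_, fun u _ => ?_, fun α s => ?_⟩
    · refine ((hP u).neg.add (((hexp u).mul (hlin u).cos).const_mul 2)).congr_deriv ?_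
      have : β = (1 - w ^ 2) / 2 := by rw [hw2]; ring
      rw [this]
      field_simp
      ring
    · rw [neg_one_mul]
      refine (hb u).trans ?_
      gcongr
      linarith
    · rw [neg_one_mul]
      have h2 : |2 * (Real.exp (-u) * Real.cos (w * u))| ≤ 2 * Real.exp (-u) := by
        rw [abs_mul, abs_mul, Real.abs_exp, abs_two]
        have := Real.abs_cos_le_one (w * u)
        gcongr
        exact mul_le_of_le_one_right (Real.exp_pos _).le this
      refine (abs_add_le _ _).trans ?_
      rw [abs_neg, add_mul]
      exact add_le_add (hb u) h2
    · rw [kernel, if_neg h.ne, if_neg (by linarith)]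
      rw [← hw, neg_div, mul_assoc, show w / α * s = w * (s / α) by ring]
  · have hP : ∀ u : ℝ, HasDerivAt (fun u => 2 * (u * Real.exp (-u)))
        (2 * ((1 - u) * Real.exp (-u))) u := fun u => by
      refine (((hasDerivAt_id u).mul (hexp u)).const_mul 2).congr_deriv ?_
      simp only [id]
      ring
    -- At critical damping the linear factor is paid for with half of the decay rate.
    have hb : ∀ u : ℝ, 0 ≤ u → u * Real.exp (-u) ≤ 2 * Real.exp (-(1 / 2) * u) := by
      intro u hu
      have h1 : Real.exp (-u) = Real.exp (-(1 / 2) * u) * Real.exp (-(1 / 2) * u) := by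
        rw [← Real.exp_add]; ring_nf
      have h2 : u / 2 * Real.exp (-(1 / 2) * u) ≤ 1 := by
        have := Real.add_one_le_exp (u / 2)
        rw [show -(1 / 2) * u = -(u / 2) by ring, Real.exp_neg, mul_inv_le_iff₀ (Real.exp_pos _)]
        linarith
      rw [h1]
      nlinarith [Real.exp_pos (-(1 / 2) * u)]
    have he : ∀ u : ℝ, 0 ≤ u → Real.exp (-u) ≤ Real.exp (-(1 / 2) * u) := fun u hu =>
      Real.exp_le_exp.2 (by linarith)
    refine ⟨6, by norm_num, 1 / 2, by norm_num, fun u => 2 * (u * Real.exp (-u)),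
      fun u => 2 * ((1 - u) * Real.exp (-u)), by simp, by simp, hP, fun u => ?_, fun u hu => ?_,
      fun u hu => ?_, fun α s => ?_⟩
    · refine ((((hasDerivAt_id u).const_sub 1).mul (hexp u)).const_mul 2).congr_deriv ?_
      simp only [id, h]
      ring
    · rw [abs_of_nonneg (by positivity)]
      have := hb u hu
      have := Real.exp_pos (-(1 / 2) * u)
      linarith
    · have h1 := hb u hu
      have h2 := he u hu
      have h3 : 0 ≤ u * Real.exp (-u) := by positivity
      have h4 := Real.exp_pos (-u)
      rw [abs_le]
      constructor <;> nlinarith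
    · rw [kernel, if_pos h, neg_div]
      ring
  · set w := √(2 * β - 1) with hw
    have hw0 : 0 < w := Real.sqrt_pos.2 (by linarith)
    have hw2 : w ^ 2 = 2 * β - 1 := Real.sq_sqrt (by linarith)
    -- This is `β < 1`; it leaves the slower overdamped mode a positive rate `1 - w`.
    have hw1 : w < 1 := by nlinarith
    have hlin : ∀ u : ℝ, HasDerivAt (fun u : ℝ => w * u) w u := fun u => by
      simpa using (hasDerivAt_id u).const_mul w
    have hP : ∀ u, HasDerivAt (fun u => 2 / w * (Real.exp (-u) * Real.sinh (w * u)))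
        (-(2 / w * (Real.exp (-u) * Real.sinh (w * u))) +
          2 * (Real.exp (-u) * Real.cosh (w * u))) u := fun u => by
      refine (((hexp u).mul (hlin u).sinh).const_mul (2 / w)).congr_deriv ?_
      field_simp
    have hab : ∀ x y : ℝ, 0 ≤ x → |y| ≤ Real.exp x → ∀ u, x = w * u →
        |Real.exp (-u) * y| ≤ Real.exp (-(1 - w) * u) := by
      intro x y hx hy u hu
      rw [abs_mul, Real.abs_exp, show -(1 - w) * u = -u + x by rw [hu]; ring, Real.exp_add]
      gcongr
    have hsc : ∀ x : ℝ, 0 ≤ x → |Real.sinh x| ≤ Real.exp x ∧ |Real.cosh x| ≤ Real.exp x := by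
      intro x hx
      have h1 := Real.exp_pos (-x)
      have h2 : Real.exp (-x) ≤ Real.exp x := Real.exp_le_exp.2 (by linarith)
      rw [Real.sinh_eq, Real.cosh_eq, abs_le, abs_le]
      refine ⟨⟨?_, ?_⟩, ?_, ?_⟩ <;> linarith
    have hb1 : ∀ u, 0 ≤ u → |2 / w * (Real.exp (-u) * Real.sinh (w * u))| ≤
        2 / w * Real.exp (-(1 - w) * u) := by
      intro u hu
      have hwu : 0 ≤ w * u := by positivity
      rw [abs_mul, abs_of_pos (by positivity : 0 < 2 / w)]
      gcongr
      exact hab _ _ hwu (hsc _ hwu).1 u rfl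
    have hb2 : ∀ u, 0 ≤ u → |2 * (Real.exp (-u) * Real.cosh (w * u))| ≤
        2 * Real.exp (-(1 - w) * u) := by
      intro u hu
      have hwu : 0 ≤ w * u := by positivity
      rw [abs_mul, abs_two]
      gcongr
      exact hab _ _ hwu (hsc _ hwu).2 u rfl
    refine ⟨2 / w + 2, by positivity, 1 - w, by linarith,
      fun u => 2 / w * (Real.exp (-u) * Real.sinh (w * u)), fun u =>
        -(2 / w * (Real.exp (-u) * Real.sinh (w * u))) + 2 * (Real.exp (-u) * Real.cosh (w * u)),
      by simp, by simp, hP, fun u => ?_, fun u hu => ?_, fun u hu => ?_, fun α s => ?_⟩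
    · refine ((hP u).neg.add (((hexp u).mul (hlin u).cosh).const_mul 2)).congr_deriv ?_
      have : β = (1 + w ^ 2) / 2 := by rw [hw2]; ring
      rw [this]
      field_simp
      ring
    · refine (hb1 u hu).trans ?_
      gcongr
      linarith
    · refine (abs_add_le _ _).trans ?_
      rw [abs_neg, add_mul]
      exact add_le_add (hb1 u hu) (hb2 u hu)
    · rw [kernel, if_neg h.ne', if_pos h]
      rw [← hw, neg_div, mul_assoc, show w / α * s = w * (s / α) by ring]

/-- The scaled equation `P''/2 + P' = -(1 - β) P` exhibits the kernel as a derivative: `P'/2 + P` is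
its tail, with value `1` at zero because `P(0) = 0` and `P'(0) = 2`. Unit mass and decay of the tail
thus hold in all three damping regimes at once, even where the kernel changes sign. -/
theorem exists_isMemoryKernel_kernelTwo {β : ℝ} (hβ0 : 0 ≤ β) (hβ : β < 1) :
    ∃ C > 0, ∃ c > 0, ∀ α, 0 < α → IsMemoryKernel C c α (kernelTwo α β) := by
  obtain ⟨C, hC, c, hc, P, P', h0, h0', hP, hP', hb, hb', hk⟩ := exists_scaled_kernel hβ
  refine ⟨2 * C, by positivity, c, hc, fun α hα => ?_⟩
  have hH : kernelTwo α β = fun s => (1 - β) / α * P (s / α) := by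
    funext s
    rw [kernelTwo, hk, rate]
  have hPc : Continuous P := continuous_iff_continuousAt.2 fun u => (hP u).continuousAt
  have hdiv : ∀ s : ℝ, HasDerivAt (fun s : ℝ => s / α) (1 / α) s := fun s =>
    (hasDerivAt_id s).div_const α
  have hexp : ∀ s : ℝ, -c * (s / α) = -(c / α) * s := fun s => by ring
  refine ⟨by rw [hH]; fun_prop, fun s hs => ?_, fun s => P' (s / α) / 2 + P (s / α),
    by simp [h0, h0'], fun s => ?_, fun s hs => ?_⟩
  · have h1 := hb (s / α) (by positivity)
    rw [hexp] at h1
    have h2 : 0 ≤ 1 - β := by linarith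
    rw [hH]
    simp only
    rw [abs_mul, abs_of_nonneg (by positivity : 0 ≤ (1 - β) / α)]
    calc (1 - β) / α * |P (s / α)| ≤ 1 / α * (C * Real.exp (-(c / α) * s)) := by
          gcongr
          linarith
      _ = C / α * Real.exp (-(c / α) * s) := by ring
      _ ≤ 2 * C / α * Real.exp (-(c / α) * s) := by
          gcongr
          linarith
  · refine ((((hP' (s / α)).comp s (hdiv s)).div_const 2).add
      ((hP (s / α)).comp s (hdiv s))).congr_deriv ?_
    rw [hH]
    simp only
    field_simp
    ring
  · have h1 := hb (s / α) (by positivity)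
    have h2 := hb' (s / α) (by positivity)
    rw [hexp] at h1 h2
    refine (abs_add_le _ _).trans ?_
    rw [abs_div, abs_two]
    have := abs_nonneg (P' (s / α))
    linarith

/-! ### Convolution against a memory kernel. -/

section

theorem integral_exp_decay {r t : ℝ} (hr : 0 < r) :
    ∫ τ in (0 : ℝ)..t, Real.exp (-r * (t - τ)) = (1 - Real.exp (-r * t)) / r := by
  have hd : ∀ τ ∈ uIcc 0 t, HasDerivAt (fun τ => Real.exp (-r * (t - τ)) / r)
      (Real.exp (-r * (t - τ))) τ := fun τ _ => by
    refine ((((hasDerivAt_id τ).const_sub t).const_mul (-r)).exp.div_const r).congr_deriv ?_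
    simp only [id]
    field_simp
  rw [intervalIntegral.integral_eq_sub_of_hasDerivAt hd
    (Continuous.intervalIntegrable (by fun_prop) _ _)]
  simp
  ring

theorem integral_exp_decay_le {r t : ℝ} (hr : 0 < r) :
    ∫ τ in (0 : ℝ)..t, Real.exp (-r * (t - τ)) ≤ 1 / r := by
  rw [integral_exp_decay hr]
  have := Real.exp_pos (-r * t)
  gcongr
  linarith

variable {F : Type*} [NormedAddCommGroup F] [NormedSpace ℝ F]

theorem norm_causalConv_le {C c α G t : ℝ} {H : ℝ → ℝ} (hH : IsMemoryKernel C c α H)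
    (hC : 0 < C) (hc : 0 < c) (hα : 0 < α) {φ : ℝ → F} (ht : 0 ≤ t) (hG0 : 0 ≤ G)
    (hG : ∀ τ ∈ Icc 0 t, ‖φ τ‖ ≤ G) : ‖causalConv H φ t‖ ≤ C / c * G := by
  have h1 : ‖causalConv H φ t‖ ≤
      ∫ τ in (0 : ℝ)..t, C / α * G * Real.exp (-(c / α) * (t - τ)) := by
    refine intervalIntegral.norm_integral_le_of_norm_le ht (Filter.Eventually.of_forall ?_)
      (Continuous.intervalIntegrable (by fun_prop) _ _)
    intro τ hτ
    have h2 := hH.2.1 (t - τ) (by linarith [hτ.2])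
    rw [norm_smul, Real.norm_eq_abs]
    calc |H (t - τ)| * ‖φ τ‖ ≤ C / α * Real.exp (-(c / α) * (t - τ)) * G := by
          gcongr
          exact hG τ ⟨hτ.1.le, hτ.2⟩
      _ = _ := by ring
  refine h1.trans ?_
  rw [intervalIntegral.integral_const_mul]
  calc C / α * G * ∫ τ in (0 : ℝ)..t, Real.exp (-(c / α) * (t - τ)) ≤ C / α * G * (1 / (c / α)) := by
        gcongr
        exact integral_exp_decay_le (by positivity)
    _ = C / c * G := by field_simp

/-- Averaging against a memory kernel reproduces the signal, up to a transient and an error of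
order `α`. -/
theorem norm_causalConv_sub_le [CompleteSpace F] {C c α A B G t : ℝ} {H : ℝ → ℝ}
    (hH : IsMemoryKernel C c α H) (hC : 0 < C) (hc : 0 < c) (hα : 0 < α) {φ φ' : ℝ → F}
    (ht : 0 ≤ t) (hB : 0 ≤ B) (hφ : ContinuousOn φ (Icc 0 t)) (hφ' : ContinuousOn φ' (Icc 0 t))
    (hd : ∀ τ ∈ Ioo 0 t, HasDerivAt φ (φ' τ) τ) (hG : ‖φ 0‖ ≤ G)
    (hb : ∀ τ ∈ Icc 0 t, ‖φ' τ‖ ≤ A / α * Real.exp (-(c / α) * τ) + B) :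
    ‖causalConv H φ t - φ t‖ ≤
      C * (G + A * (t / α)) * Real.exp (-(c / α) * t) + C * B / c * α := by
  obtain ⟨hHc, -, E, hE0, hE, hEb⟩ := hH
  have hEc : Continuous E := continuous_iff_continuousAt.2 fun u => (hE u).continuousAt
  have i1 : IntervalIntegrable (fun τ => H (t - τ) • φ τ) volume 0 t := by
    apply ContinuousOn.intervalIntegrable
    rw [uIcc_of_le ht]
    exact (hHc.comp (continuous_const.sub continuous_id)).continuousOn.smul hφ
  have c2 : ContinuousOn (fun τ => E (t - τ) • φ' τ) (Icc 0 t) :=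
    (hEc.comp (continuous_const.sub continuous_id)).continuousOn.smul hφ'
  have i2 : IntervalIntegrable (fun τ => E (t - τ) • φ' τ) volume 0 t := by
    apply ContinuousOn.intervalIntegrable
    rwa [uIcc_of_le ht]
  -- Integration by parts: `-H` is the derivative of `E`, so `τ ↦ E (t - τ) • φ τ` has derivative `H
  -- (t - τ) • φ τ + E (t - τ) • φ' τ`. The endpoint `τ = t` yields `φ t` exactly, and the endpoint
  -- `τ = 0` the transient.
  have hftc : ∫ τ in (0 : ℝ)..t, (H (t - τ) • φ τ + E (t - τ) • φ' τ) =
      E (t - t) • φ t - E (t - 0) • φ 0 := by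
    refine intervalIntegral.integral_eq_sub_of_hasDerivAt_of_le
      (f := fun τ => E (t - τ) • φ τ) ht
      ((hEc.comp (continuous_const.sub continuous_id)).continuousOn.smul hφ) ?_ (i1.add i2)
    intro τ hτ
    have h1 : HasDerivAt (fun τ => E (t - τ)) (H (t - τ)) τ := by
      have := (hE (t - τ)).comp τ ((hasDerivAt_id τ).const_sub t)
      simpa [Function.comp_def] using this
    refine (h1.smul (hd τ hτ)).congr_deriv ?_
    rw [add_comm]
  rw [intervalIntegral.integral_add i1 i2, sub_self, sub_zero, hE0, one_smul] at hftc
  have heq : causalConv H φ t - φ t =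
      -(E t • φ 0) - ∫ τ in (0 : ℝ)..t, E (t - τ) • φ' τ := by
    rw [causalConv, eq_sub_of_add_eq hftc]
    abel
  -- The tail and the spike in `φ'` decay at the same rate, so their product is constant in `τ` and
  -- integrates to `t/α` times `e^{-ct/α}`.
  have hI : ‖∫ τ in (0 : ℝ)..t, E (t - τ) • φ' τ‖ ≤ ∫ τ in (0 : ℝ)..t,
      (C * (A / α) * Real.exp (-(c / α) * t) + C * B * Real.exp (-(c / α) * (t - τ))) := by
    refine intervalIntegral.norm_integral_le_of_norm_le ht (Filter.Eventually.of_forall ?_)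
      (Continuous.intervalIntegrable (by fun_prop) _ _)
    intro τ hτ
    have h2 := hEb (t - τ) (by linarith [hτ.2])
    have h3 := hb τ ⟨hτ.1.le, hτ.2⟩
    rw [norm_smul, Real.norm_eq_abs]
    calc |E (t - τ)| * ‖φ' τ‖ ≤ C * Real.exp (-(c / α) * (t - τ)) *
          (A / α * Real.exp (-(c / α) * τ) + B) := by gcongr
      _ = C * (A / α) * (Real.exp (-(c / α) * (t - τ)) * Real.exp (-(c / α) * τ)) +
          C * B * Real.exp (-(c / α) * (t - τ)) := by ring
      _ = _ := by rw [← Real.exp_add]; ring_nf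
  have hI2 : ∫ τ in (0 : ℝ)..t,
      (C * (A / α) * Real.exp (-(c / α) * t) + C * B * Real.exp (-(c / α) * (t - τ))) ≤
      C * A * (t / α) * Real.exp (-(c / α) * t) + C * B / c * α := by
    rw [intervalIntegral.integral_add (by simp) (Continuous.intervalIntegrable (by fun_prop) _ _),
      intervalIntegral.integral_const, intervalIntegral.integral_const_mul, smul_eq_mul, sub_zero]
    have := integral_exp_decay_le (r := c / α) (t := t) (by positivity)
    calc _ ≤ t * (C * (A / α) * Real.exp (-(c / α) * t)) + C * B * (1 / (c / α)) := by gcongr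
      _ = _ := by field_simp
  have hE1 : ‖E t • φ 0‖ ≤ C * Real.exp (-(c / α) * t) * G := by
    rw [norm_smul, Real.norm_eq_abs]
    have := hEb t ht
    gcongr
  rw [heq]
  calc _ ≤ ‖-(E t • φ 0)‖ + ‖∫ τ in (0 : ℝ)..t, E (t - τ) • φ' τ‖ := norm_sub_le _ _
    _ ≤ C * Real.exp (-(c / α) * t) * G +
        (C * A * (t / α) * Real.exp (-(c / α) * t) + C * B / c * α) := by
      rw [norm_neg]
      exact add_le_add hE1 (hI.trans hI2)
    _ = _ := by ring

theorem exp_neg_le_inv {x : ℝ} (hx : 0 < x) : Real.exp (-x) ≤ 1 / x := by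
  rw [Real.exp_neg, one_div]
  have := Real.add_one_le_exp x
  gcongr
  linarith

theorem mul_exp_neg_le_inv {x : ℝ} (hx : 0 < x) : x * Real.exp (-x) ≤ 2 / x := by
  rw [Real.exp_neg, ← div_eq_mul_inv, div_le_div_iff₀ (Real.exp_pos _) hx]
  have := Real.quadratic_le_exp_of_nonneg hx.le
  nlinarith

/-- Past a fixed positive time, averaging against a memory kernel reproduces the signal up to
an error of order `α`. -/
theorem norm_causalConv_sub_le_of_le [CompleteSpace F] {C c α A B G δ t : ℝ} {H : ℝ → ℝ}
    (hH : IsMemoryKernel C c α H) (hC : 0 < C) (hc : 0 < c) (hα : 0 < α) {φ φ' : ℝ → F}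
    (hδ : 0 < δ) (ht : δ ≤ t) (hA : 0 ≤ A) (hB : 0 ≤ B)
    (hφ : ContinuousOn φ (Icc 0 t)) (hφ' : ContinuousOn φ' (Icc 0 t))
    (hd : ∀ τ ∈ Ioo 0 t, HasDerivAt φ (φ' τ) τ) (hG : ‖φ 0‖ ≤ G)
    (hb : ∀ τ ∈ Icc 0 t, ‖φ' τ‖ ≤ A / α * Real.exp (-(c / α) * τ) + B) :
    ‖causalConv H φ t - φ t‖ ≤
      (C * (G / (c * δ) + 2 * A / (c ^ 2 * δ)) + C * B / c) * α := by
  have ht0 : 0 < t := hδ.trans_le ht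
  have hG0 : 0 ≤ G := (norm_nonneg _).trans hG
  refine (norm_causalConv_sub_le hH hC hc hα ht0.le hB hφ hφ' hd hG hb).trans ?_
  have hx : 0 < c / α * t := by positivity
  have h1 := exp_neg_le_inv hx
  have h2 := mul_exp_neg_le_inv hx
  have h3 : Real.exp (-(c / α) * t) ≤ α / (c * δ) := by
    rw [neg_mul]
    refine h1.trans ?_
    calc 1 / (c / α * t) = α / (c * t) := by field_simp
      _ ≤ _ := by gcongr
  have h4 : t / α * Real.exp (-(c / α) * t) ≤ 2 * α / (c ^ 2 * δ) := by
    rw [neg_mul]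
    calc t / α * Real.exp (-(c / α * t)) = c / α * t * Real.exp (-(c / α * t)) / c := by
          field_simp
      _ ≤ 2 / (c / α * t) / c := by gcongr
      _ = 2 * α / (c ^ 2 * t) := by field_simp
      _ ≤ _ := by gcongr
  calc C * (G + A * (t / α)) * Real.exp (-(c / α) * t) + C * B / c * α
      = C * (G * Real.exp (-(c / α) * t) + A * (t / α * Real.exp (-(c / α) * t))) +
        C * B / c * α := by ring
    _ ≤ C * (G * (α / (c * δ)) + A * (2 * α / (c ^ 2 * δ))) + C * B / c * α := by gcongr
    _ = _ := by ring

theorem causalConv_kernelOne_eq {α β : ℝ} {φ : ℝ → F} :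
    causalConv (kernelOne α β) φ = fun t => (rate α β * Real.exp (-(rate α β) * t)) •
      ∫ τ in (0 : ℝ)..t, Real.exp (rate α β * τ) • φ τ := by
  funext t
  rw [causalConv, ← intervalIntegral.integral_smul]
  refine intervalIntegral.integral_congr fun τ _ => ?_
  simp only [kernelOne]
  rw [smul_smul, mul_assoc, ← Real.exp_add]
  ring_nf

/-- The first-order average `M` of `φ` solves `M' = λ (φ - M)`. -/
theorem hasDerivAt_causalConv_kernelOne [CompleteSpace F] {α β T t : ℝ} {φ : ℝ → F}
    (hφ : ContinuousOn φ (Icc 0 T)) (ht : t ∈ Ioo 0 T) :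
    HasDerivAt (causalConv (kernelOne α β) φ)
      (rate α β • (φ t - causalConv (kernelOne α β) φ t)) t := by
  set r := rate α β with hr
  have hc : ContinuousOn (fun τ => Real.exp (r * τ) • φ τ) (Icc 0 T) :=
    (Continuous.continuousOn (by fun_prop)).smul hφ
  have hsub : uIcc 0 t ⊆ Icc 0 T := by
    rw [uIcc_of_le ht.1.le]
    exact Icc_subset_Icc_right ht.2.le
  have hI : HasDerivAt (fun t => ∫ τ in (0 : ℝ)..t, Real.exp (r * τ) • φ τ)
      (Real.exp (r * t) • φ t) t := by
    refine intervalIntegral.integral_hasDerivAt_right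
      ((hc.mono hsub).intervalIntegrable) ?_ (hc.continuousAt (Icc_mem_nhds ht.1 ht.2))
    exact (hc.mono Ioo_subset_Icc_self).stronglyMeasurableAtFilter isOpen_Ioo t ht
  have hE : HasDerivAt (fun t => r * Real.exp (-r * t)) (-r * (r * Real.exp (-r * t))) t := by
    refine (((hasDerivAt_id t).const_mul (-r)).exp.const_mul r).congr_deriv ?_
    simp only [id]
    ring
  rw [causalConv_kernelOne_eq]
  refine (hE.smul hI).congr_deriv ?_
  simp only
  rw [smul_smul, mul_assoc, ← Real.exp_add, smul_sub]
  simp only [neg_mul, neg_add_cancel, Real.exp_zero, mul_one, neg_smul, smul_smul]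
  abel

theorem continuousOn_causalConv_kernelOne {α β T : ℝ} {φ : ℝ → F}
    (hφ : ContinuousOn φ (Icc 0 T)) (hT : 0 ≤ T) :
    ContinuousOn (causalConv (kernelOne α β) φ) (Icc 0 T) := by
  rw [causalConv_kernelOne_eq]
  have hc : ContinuousOn (fun τ => Real.exp (rate α β * τ) • φ τ) (uIcc 0 T) := by
    rw [uIcc_of_le hT]
    exact (Continuous.continuousOn (by fun_prop)).smul hφ
  have := intervalIntegral.continuousOn_primitive_interval
    (μ := volume) (hc.integrableOn_compact isCompact_uIcc)
  rw [uIcc_of_le hT] at this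
  exact (Continuous.continuousOn (by fun_prop)).smul this

end

/-! ### Velocity bounds for `(α/2) θ'' + θ' = F`. -/

section Velocity

variable {F : Type*} [NormedAddCommGroup F] [NormedSpace ℝ F]

/-- A bounded forcing determines the velocity of `(α/2) θ'' + θ' = F` up to the transient
`e^{-2t/α} θ'(0)`. -/
theorem norm_velocity_sub_transient_le {u a : ℝ → F} {α B S : ℝ} (hα : 0 < α)
    (hu : ∀ t ∈ Icc 0 S, HasDerivWithinAt u (a t) (Icc 0 S) t)
    (hF : ∀ t ∈ Icc 0 S, ‖(α / 2) • a t + u t‖ ≤ B) {t : ℝ} (ht : t ∈ Icc 0 S) :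
    ‖u t - Real.exp (-(2 / α) * t) • u 0‖ ≤ B := by
  have hB : 0 ≤ B := (norm_nonneg _).trans (hF t ht)
  have he : ∀ t : ℝ, HasDerivAt (fun t => Real.exp (2 / α * t))
      (2 / α * Real.exp (2 / α * t)) t := fun t => by
    refine ((hasDerivAt_id t).const_mul (2 / α)).exp.congr_deriv ?_
    simp only [id]
    ring
  -- Integrating factor `e^{2t/α}`: the derivative is the forcing times a scalar, and the norm is
  -- compared with `B (e^{2t/α} - 1)`.
  have hw : ∀ t ∈ Icc 0 S, HasDerivWithinAt (fun t => Real.exp (2 / α * t) • u t - u 0)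
      ((2 / α * Real.exp (2 / α * t)) • ((α / 2) • a t + u t)) (Icc 0 S) t := fun t ht => by
    refine (((he t).hasDerivWithinAt.smul (hu t ht)).sub_const (u 0)).congr_deriv ?_
    rw [smul_add, smul_smul, show 2 / α * Real.exp (2 / α * t) * (α / 2) = Real.exp (2 / α * t) by
      field_simp]
  have key := image_norm_le_of_norm_deriv_right_le_deriv_boundary
    (B := fun t => B * Real.exp (2 / α * t) - B) (B' := fun t => B * (2 / α * Real.exp (2 / α * t)))
    (fun t ht => (hw t ht).continuousWithinAt)
    (fun t ht => ((hw t ⟨ht.1, ht.2.le⟩).mono_of_mem_nhdsWithin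
      (Icc_mem_nhdsGE_of_mem ht))) (by simp)
    (fun t => ((he t).const_mul B).sub_const B)
    (fun t ht => by
      rw [norm_smul, Real.norm_eq_abs, abs_of_pos (by positivity), mul_comm B]
      have := hF t ⟨ht.1, ht.2.le⟩
      gcongr) ht
  have hx : u t - Real.exp (-(2 / α) * t) • u 0 =
      Real.exp (-(2 / α) * t) • (Real.exp (2 / α * t) • u t - u 0) := by
    rw [smul_sub, smul_smul, ← Real.exp_add]
    simp
  rw [hx, norm_smul, Real.norm_eq_abs, Real.abs_exp]
  have h1 : Real.exp (-(2 / α) * t) * Real.exp (2 / α * t) = 1 := by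
    rw [← Real.exp_add]
    simp
  have h2 := Real.exp_pos (-(2 / α) * t)
  calc _ ≤ Real.exp (-(2 / α) * t) * (B * Real.exp (2 / α * t) - B) := by gcongr
    _ = B * (Real.exp (-(2 / α) * t) * Real.exp (2 / α * t)) - Real.exp (-(2 / α) * t) * B := by
      ring
    _ ≤ B := by
      rw [h1]
      nlinarith

/-- A bounded trajectory of `(α/2) θ'' + θ' = F` with bounded forcing has initial velocity of
order `1 / α`. -/
theorem norm_initial_velocity_le {θ u a : ℝ → F} {α B R S : ℝ} (hα : 0 < α) (hαS : α ≤ S)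
    (hθ : ∀ t ∈ Icc 0 S, HasDerivWithinAt θ (u t) (Icc 0 S) t)
    (hu : ∀ t ∈ Icc 0 S, HasDerivWithinAt u (a t) (Icc 0 S) t)
    (hF : ∀ t ∈ Icc 0 S, ‖(α / 2) • a t + u t‖ ≤ B) (hR : ∀ t ∈ Icc 0 S, ‖θ t‖ ≤ R) :
    ‖u 0‖ ≤ (8 * R + 6 * B * α) / α := by
  have m0 : (0 : ℝ) ∈ Icc 0 S := ⟨le_rfl, hα.le.trans hαS⟩
  have mα : α ∈ Icc 0 S := ⟨hα.le, hαS⟩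
  have h1 := norm_velocity_sub_transient_le hα hu hF mα
  -- The derivative of `θ + (α/2) u` is the forcing, so this quantity moves by at most `Bα` over a
  -- time `α`. As `θ` is bounded by `R`, the drop of `u` is then `O(1/α)`.
  have h2 : ‖(θ α + (α / 2) • u α) - (θ 0 + (α / 2) • u 0)‖ ≤ B * ‖α - 0‖ := by
    refine (convex_Icc 0 S).norm_image_sub_le_of_norm_hasDerivWithin_le
      (f := fun t => θ t + (α / 2) • u t) (f' := fun t => u t + (α / 2) • a t)
      (fun t ht => (hθ t ht).add ((hu t ht).const_smul (α / 2))) (fun t ht => ?_) m0 mα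
    rw [add_comm]
    exact hF t ht
  rw [sub_zero, Real.norm_eq_abs, abs_of_pos hα] at h2
  have h3 : ‖(α / 2) • (u 0 - u α)‖ ≤ 2 * R + B * α := by
    have : (α / 2) • (u 0 - u α) =
        θ α - θ 0 - ((θ α + (α / 2) • u α) - (θ 0 + (α / 2) • u 0)) := by
      rw [smul_sub]
      abel
    rw [this]
    have := norm_sub_le (θ α - θ 0) ((θ α + (α / 2) • u α) - (θ 0 + (α / 2) • u 0))
    have := norm_sub_le (θ α) (θ 0)
    have := hR _ m0
    have := hR _ mα
    linarith
  rw [norm_smul, Real.norm_eq_abs, abs_of_pos (by positivity)] at h3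
  -- Over a time `α` at least half of the initial velocity is lost, so the drop `u 0 - u α` controls
  -- `u 0` itself. Doubling `(4R + 2Bα) + Bα` gives `8R + 6Bα`.
  have h4 : ‖u α‖ ≤ 1 / 2 * ‖u 0‖ + B := by
    have e : Real.exp (-(2 / α) * α) ≤ 1 / 2 := by
      rw [neg_mul, div_mul_cancel₀ _ hα.ne']
      exact exp_neg_le_inv two_pos
    have h5 : ‖Real.exp (-(2 / α) * α) • u 0‖ ≤ 1 / 2 * ‖u 0‖ := by
      rw [norm_smul, Real.norm_eq_abs, Real.abs_exp]
      gcongr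
    have := norm_le_insert' (u α) (Real.exp (-(2 / α) * α) • u 0)
    linarith
  have h6 : ‖u 0‖ ≤ ‖u α‖ + ‖u 0 - u α‖ := norm_le_insert' _ _
  rw [le_div_iff₀ hα]
  nlinarith

/-- Velocity bound, uniform up to an initial layer. The forcing is only controlled up to `T - α`;
on `[T - α, T]` the acceleration is. -/
theorem norm_velocity_le {θ u a : ℝ → F} {α B R CT δ T : ℝ} (hα : 0 < α) (hαδ : α < δ)
    (hδ : δ ≤ T - α) (hR0 : 0 ≤ R) (hCT : 0 ≤ CT)
    (hθ : ∀ t ∈ Icc 0 T, HasDerivWithinAt θ (u t) (Icc 0 T) t)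
    (hu : ∀ t ∈ Icc 0 T, HasDerivWithinAt u (a t) (Icc 0 T) t)
    (hF : ∀ t ∈ Icc 0 (T - α), ‖(α / 2) • a t + u t‖ ≤ B) (hR : ∀ t ∈ Icc 0 T, ‖θ t‖ ≤ R)
    (ha : ∀ t ∈ Icc (δ - α) T, ‖a t‖ ≤ CT) {t : ℝ} (ht : t ∈ Icc 0 T) :
    ‖u t‖ ≤ (Real.exp 2 * (8 * R + 6 * B * δ)) / α * Real.exp (-(2 / α) * t) +
      (B + CT * δ) := by
  have hS : Icc 0 (T - α) ⊆ Icc 0 T := Icc_subset_Icc_right (by linarith)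
  have mS : T - α ∈ Icc 0 (T - α) := ⟨by linarith, le_rfl⟩
  have hB : 0 ≤ B := (norm_nonneg _).trans (hF _ mS)
  have h0 : ‖u 0‖ ≤ (8 * R + 6 * B * δ) / α := by
    refine (norm_initial_velocity_le hα (by linarith : α ≤ T - α)
      (fun t ht => (hθ t (hS ht)).mono hS) (fun t ht => (hu t (hS ht)).mono hS) hF
      fun t ht => hR t (hS ht)).trans ?_
    gcongr
  have hmain : ∀ t ∈ Icc 0 (T - α),
      ‖u t‖ ≤ (8 * R + 6 * B * δ) / α * Real.exp (-(2 / α) * t) + B := by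
    intro t ht
    have h1 := norm_velocity_sub_transient_le hα (fun t ht => (hu t (hS ht)).mono hS) hF ht
    have h2 := norm_le_insert' (u t) (Real.exp (-(2 / α) * t) • u 0)
    rw [norm_smul, Real.norm_eq_abs, Real.abs_exp] at h2
    have h3 : Real.exp (-(2 / α) * t) * ‖u 0‖ ≤
        Real.exp (-(2 / α) * t) * ((8 * R + 6 * B * δ) / α) := by gcongr
    linarith
  have hA : 0 ≤ (8 * R + 6 * B * δ) / α := by
    have : 0 < δ := hα.trans hαδ
    positivity
  have hCδ : 0 ≤ CT * δ := mul_nonneg hCT (hα.trans hαδ).le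
  rcases le_total t (T - α) with h | h
  · refine (hmain t ⟨ht.1, h⟩).trans ?_
    have : 1 ≤ Real.exp 2 := Real.one_le_exp (by norm_num)
    have h2 : 1 * ((8 * R + 6 * B * δ) / α * Real.exp (-(2 / α) * t)) ≤
        Real.exp 2 * ((8 * R + 6 * B * δ) / α * Real.exp (-(2 / α) * t)) := by gcongr
    rw [show Real.exp 2 * (8 * R + 6 * B * δ) / α * Real.exp (-(2 / α) * t) =
      Real.exp 2 * ((8 * R + 6 * B * δ) / α * Real.exp (-(2 / α) * t)) by ring]
    linarith
  · have h1 := hmain _ mS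
    have h2 : ‖u t - u (T - α)‖ ≤ CT * ‖t - (T - α)‖ := by
      have hsub : Icc (T - α) T ⊆ Icc 0 T := Icc_subset_Icc_left mS.1
      exact (convex_Icc (T - α) T).norm_image_sub_le_of_norm_hasDerivWithin_le
        (fun s hs => (hu s (hsub hs)).mono hsub)
        (fun s hs => ha s ⟨by linarith [hs.1], hs.2⟩)
        ⟨le_rfl, by linarith⟩ ⟨h, ht.2⟩
    rw [Real.norm_eq_abs, abs_of_nonneg (by linarith)] at h2
    have h3 : CT * (t - (T - α)) ≤ CT * δ := by
      gcongr
      linarith [ht.2]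
    have h4 := norm_le_insert' (u t) (u (T - α))
    -- Carrying the transient from `T - α` to a later `t ≤ T` costs at most `e²`, which is the
    -- factor in the statement.
    have h5 : Real.exp (-(2 / α) * (T - α)) ≤ Real.exp 2 * Real.exp (-(2 / α) * t) := by
      rw [← Real.exp_add]
      apply Real.exp_le_exp.2
      have : -(2 / α) * (T - α) = 2 + -(2 / α) * T := by
        field_simp
        ring
      rw [this]
      have : 2 / α * t ≤ 2 / α * T := by
        have := ht.2
        gcongr
      linarith
    have h6 : (8 * R + 6 * B * δ) / α * Real.exp (-(2 / α) * (T - α)) ≤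
        (8 * R + 6 * B * δ) / α * (Real.exp 2 * Real.exp (-(2 / α) * t)) := by gcongr
    rw [show Real.exp 2 * (8 * R + 6 * B * δ) / α * Real.exp (-(2 / α) * t) =
      (8 * R + 6 * B * δ) / α * (Real.exp 2 * Real.exp (-(2 / α) * t)) by ring]
    linarith

end Velocity

/-! ### Bias corrections, uniformly in `α`. -/

section Bias

variable {β x : ℝ}

/-- Applied with `x = t/α` and `t ≥ α`, this keeps every denominator `1 - β^{t/α}` above `1 - β`,
however small `α` is. -/
theorem rpow_mem_of_one_le (h0 : 0 ≤ β) (h1 : β < 1) (hx : 1 ≤ x) :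
    0 ≤ β ^ x ∧ β ^ x ≤ β := by
  refine ⟨Real.rpow_nonneg h0 _, ?_⟩
  have := Real.rpow_le_rpow_of_exponent_ge' h0 h1.le zero_le_one hx
  rwa [Real.rpow_one] at this

variable {α β₁ β₂ ε t v w : ℝ}

theorem effective_scalar_nonneg (h₁ : 0 ≤ β₁) (h₁' : β₁ < 1)
    (hε : 0 < ε) (hα : 0 < α) (ht : α ≤ t) :
    0 ≤ biasEta α β₁ β₂ t / (√v + biasEps α β₂ ε t) := by
  have hx : 1 ≤ t / α := (one_le_div hα).2 ht
  obtain ⟨_, b₁'⟩ := rpow_mem_of_one_le h₁ h₁' hx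
  unfold biasEta biasEps
  have : 0 < 1 - β₁ ^ (t / α) := by linarith
  positivity

/-- The factor `√(1 - β₂^{t/α})` occurs in both `η(t)` and `ε(t)`; after `√v ≥ 0` is dropped it
cancels. -/
theorem effective_scalar_le (h₁ : 0 ≤ β₁) (h₁' : β₁ < 1) (h₂ : 0 ≤ β₂) (h₂' : β₂ < 1)
    (hε : 0 < ε) (hα : 0 < α) (ht : α ≤ t) :
    biasEta α β₁ β₂ t / (√v + biasEps α β₂ ε t) ≤ 1 / (ε * (1 - β₁)) := by
  have hx : 1 ≤ t / α := (one_le_div hα).2 ht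
  obtain ⟨_, b₁'⟩ := rpow_mem_of_one_le h₁ h₁' hx
  obtain ⟨_, b₂'⟩ := rpow_mem_of_one_le h₂ h₂' hx
  unfold biasEta biasEps
  have p₁ : 0 < 1 - β₁ ^ (t / α) := by linarith
  have p₁' : 0 < 1 - β₁ := by linarith
  have p₂ : 0 < √(1 - β₂ ^ (t / α)) := Real.sqrt_pos.2 (by linarith)
  set s := √(1 - β₂ ^ (t / α))
  calc s / (1 - β₁ ^ (t / α)) / (√v + ε * s) ≤ s / (1 - β₁) / (0 + ε * s) := by
        gcongr
        exact Real.sqrt_nonneg _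
    _ = _ := by field_simp; simp

theorem le_effective_scalar (h₁ : 0 ≤ β₁) (h₁' : β₁ < 1) (h₂ : 0 ≤ β₂) (h₂' : β₂ < 1)
    (hε : 0 < ε) (hα : 0 < α) (ht : α ≤ t) (hv : v ≤ w) :
    √(1 - β₂) / (√w + ε) ≤ biasEta α β₁ β₂ t / (√v + biasEps α β₂ ε t) := by
  have hx : 1 ≤ t / α := (one_le_div hα).2 ht
  obtain ⟨b₁, b₁'⟩ := rpow_mem_of_one_le h₁ h₁' hx
  obtain ⟨b₂, b₂'⟩ := rpow_mem_of_one_le h₂ h₂' hx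
  unfold biasEta biasEps
  have p₁ : 0 < 1 - β₁ ^ (t / α) := by linarith
  have p₂ : 0 < √(1 - β₂ ^ (t / α)) := Real.sqrt_pos.2 (by linarith)
  have p₂' : √(1 - β₂ ^ (t / α)) ≤ 1 := Real.sqrt_le_one.2 (by linarith)
  have p₃ : √(1 - β₂) ≤ √(1 - β₂ ^ (t / α)) := Real.sqrt_le_sqrt (by linarith)
  have p₄ : √(1 - β₂ ^ (t / α)) ≤ √(1 - β₂ ^ (t / α)) / (1 - β₁ ^ (t / α)) := by
    rw [le_div_iff₀ p₁]
    nlinarith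
  have p₅ : √v ≤ √w := Real.sqrt_le_sqrt hv
  have p₆ : 0 ≤ √v := Real.sqrt_nonneg _
  apply div_le_div₀
  · positivity
  · exact p₃.trans p₄
  · positivity
  · nlinarith

/-- The effective scalar with the bias correction of the second moment absorbed. -/
theorem effective_scalar_eq (h₂ : 0 ≤ β₂) (h₂' : β₂ < 1) (hα : 0 < α) (ht : α ≤ t) :
    biasEta α β₁ β₂ t / (√v + biasEps α β₂ ε t) =
      1 / (1 - β₁ ^ (t / α)) / (√(v / (1 - β₂ ^ (t / α))) + ε) := by
  have hx : 1 ≤ t / α := (one_le_div hα).2 ht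
  obtain ⟨b₂, b₂'⟩ := rpow_mem_of_one_le h₂ h₂' hx
  unfold biasEta biasEps
  have p₂ : 0 < √(1 - β₂ ^ (t / α)) := Real.sqrt_pos.2 (by linarith)
  rw [Real.sqrt_div' _ (by linarith)]
  set s := √(1 - β₂ ^ (t / α))
  rw [show √v / s + ε = (√v + ε * s) / s by field_simp]
  rw [div_div_eq_mul_div, div_mul_eq_mul_div, one_mul]

/-- Past a fixed time `δ`, the powers `β ^ (t / α)` are Lipschitz in `t`, uniformly in `α`. -/
theorem abs_rpow_div_sub_le {a b δ : ℝ} (h0 : 0 ≤ β) (h1 : β < 1) (hα : 0 < α) (hδ : 0 < δ)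
    (ha : δ ≤ a) (hab : a ≤ b) : |β ^ (b / α) - β ^ (a / α)| ≤ (b - a) / δ := by
  rcases h0.eq_or_lt with rfl | h0
  · have ha' : a / α ≠ 0 := (div_pos (hδ.trans_le ha) hα).ne'
    have hb' : b / α ≠ 0 := (div_pos (hδ.trans_le (ha.trans hab)) hα).ne'
    rw [Real.zero_rpow ha', Real.zero_rpow hb', sub_self, abs_zero]
    exact div_nonneg (by linarith) hδ.le
  · set l := -Real.log β / α with hl
    have hl0 : 0 < l := div_pos (neg_pos.2 (Real.log_neg h0 h1)) hα
    have he : ∀ t, β ^ (t / α) = Real.exp (-(l * t)) := fun t => by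
      rw [Real.rpow_def_of_pos h0, hl]
      congr 1
      ring
    have e1 : Real.exp (-(l * b)) ≤ Real.exp (-(l * a)) := Real.exp_le_exp.2 (by nlinarith)
    rw [he, he, abs_sub_comm, abs_of_nonneg (by linarith)]
    have e2 : Real.exp (-(l * b)) = Real.exp (-(l * a)) * Real.exp (-(l * (b - a))) := by
      rw [← Real.exp_add]
      ring_nf
    have e3 : 1 - l * (b - a) ≤ Real.exp (-(l * (b - a))) := by
      have := Real.add_one_le_exp (-(l * (b - a)))
      linarith
    have e4 : Real.exp (-(l * a)) ≤ 1 / (l * a) := exp_neg_le_inv (by nlinarith)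
    have ha0 : 0 < a := hδ.trans_le ha
    have hab0 : 0 ≤ b - a := by linarith
    calc Real.exp (-(l * a)) - Real.exp (-(l * b))
        = Real.exp (-(l * a)) * (1 - Real.exp (-(l * (b - a)))) := by rw [e2]; ring
      _ ≤ Real.exp (-(l * a)) * (l * (b - a)) := by
          gcongr
          linarith
      _ ≤ 1 / (l * a) * (l * (b - a)) := by gcongr
      _ = (b - a) / a := by field_simp
      _ ≤ (b - a) / δ := by gcongr

end Bias

/-! ### Uniform control of admissible trajectories. -/

section

variable {d : ℕ} {f : EuclideanSpace ℝ (Fin d) → ℝ} {x₀ : EuclideanSpace ℝ (Fin d)}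
  {β₁ β₂ ε δ T CT α : ℝ} {θ : ℝ → EuclideanSpace ℝ (Fin d)}

theorem contDiff_gradient (hf : ContDiff ℝ 4 f) : ContDiff ℝ 3 (gradient f) :=
  (InnerProductSpace.toDual ℝ (EuclideanSpace ℝ (Fin d))).symm.contDiff.comp
    (hf.fderiv_right (by norm_num))

theorem exists_gradient_bounds (hf : ContDiff ℝ 4 f) (hS : IsCompact (sublevel f x₀)) :
    ∃ G > 0, ∃ L > 0, ∃ R > 0, ∀ x ∈ sublevel f x₀,
      ‖gradient f x‖ ≤ G ∧ ‖fderiv ℝ (gradient f) x‖ ≤ L ∧ ‖x‖ ≤ R := by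
  have hg := contDiff_gradient hf
  obtain ⟨G, hG⟩ := hS.exists_bound_of_continuousOn hg.continuous.continuousOn
  obtain ⟨L, hL⟩ := hS.exists_bound_of_continuousOn
    (hg.continuous_fderiv (by norm_num)).continuousOn
  obtain ⟨R, hR⟩ := hS.exists_bound_of_continuousOn continuous_id.continuousOn
  refine ⟨|G| + 1, by positivity, |L| + 1, by positivity, |R| + 1, by positivity,
    fun x hx => ⟨?_, ?_, ?_⟩⟩
  · linarith [hG x hx, le_abs_self G]
  · linarith [hL x hx, le_abs_self L]
  · have := hR x hx
    simp only [id] at this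
    linarith [le_abs_self R]

/-- The quantitative information on a trajectory that the convergence estimates rest on. -/
structure IsControlled (f : EuclideanSpace ℝ (Fin d) → ℝ) (α β₁ β₂ δ T K : ℝ)
    (θ : ℝ → EuclideanSpace ℝ (Fin d)) : Prop where
  hasDerivAt : ∀ t ∈ Ioo 0 T, HasDerivAt θ (derivWithin θ (Icc 0 T) t) t
  continuousOn : ContinuousOn θ (Icc 0 T)
  gradient_le : ∀ t ∈ Icc 0 T, ‖gradient f (θ t)‖ ≤ K
  gradient_lipschitz : ∀ s ∈ Icc δ T, ∀ t ∈ Icc δ T,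
    ‖gradient f (θ t) - gradient f (θ s)‖ ≤ K * |t - s|
  moment_sub : ∀ t ∈ Icc δ T, ‖moment f α β₁ θ t - gradient f (θ t)‖ ≤ K * α
  momentOne_sub : ∀ t ∈ Icc δ T, ‖momentOne f α β₁ θ t - gradient f (θ t)‖ ≤ K * α
  secondMomentOne_sub : ∀ t ∈ Icc δ T,
    |secondMomentOne f α β₂ θ t - ‖gradient f (θ t)‖ ^ 2| ≤ K * α
  momentOne_le : ∀ t ∈ Icc 0 T, ‖momentOne f α β₁ θ t‖ ≤ K
  secondMoment_le : ∀ t ∈ Icc 0 T, |secondMoment f α β₂ θ t| ≤ K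
  secondMomentOne_le : ∀ t ∈ Icc 0 T, |secondMomentOne f α β₂ θ t| ≤ K

/-- One pair of constants serves all four kernels. The cap `c ≤ 2` lets the velocity transient
`e^{-2t/α}` be bounded by `e^{-ct/α}`, the form required by the averaging estimate. -/
theorem exists_common_memoryKernel (hβ₁ : 0 ≤ β₁) (hβ₁' : β₁ < 1) (hβ₂ : 0 ≤ β₂) (hβ₂' : β₂ < 1) :
    ∃ C > 0, ∃ c > 0, c ≤ 2 ∧ ∀ α, 0 < α →
      IsMemoryKernel C c α (kernelOne α β₁) ∧ IsMemoryKernel C c α (kernelOne α β₂) ∧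
      IsMemoryKernel C c α (kernelTwo α β₁) ∧ IsMemoryKernel C c α (kernelTwo α β₂) := by
  obtain ⟨C₁, hC₁, c₁, hc₁, h₁⟩ := exists_isMemoryKernel_kernelTwo hβ₁ hβ₁'
  obtain ⟨C₂, hC₂, c₂, hc₂, h₂⟩ := exists_isMemoryKernel_kernelTwo hβ₂ hβ₂'
  set c := min (min c₁ c₂) (min (1 - β₁) (1 - β₂)) with hc
  have hc0 : 0 < c := lt_min (lt_min hc₁ hc₂) (lt_min (by linarith) (by linarith))
  have e1 : c ≤ c₁ := (min_le_left _ _).trans (min_le_left _ _)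
  have e2 : c ≤ c₂ := (min_le_left _ _).trans (min_le_right _ _)
  have e3 : c ≤ 1 - β₁ := (min_le_right _ _).trans (min_le_left _ _)
  have e4 : c ≤ 1 - β₂ := (min_le_right _ _).trans (min_le_right _ _)
  refine ⟨C₁ + C₂ + 1, by positivity, c, hc0, by linarith, fun α hα => ⟨?_, ?_, ?_, ?_⟩⟩
  · exact (isMemoryKernel_kernelOne hα hβ₁ hβ₁').mono hα zero_le_one (by linarith) e3
  · exact (isMemoryKernel_kernelOne hα hβ₂ hβ₂').mono hα zero_le_one (by linarith) e4
  · exact (h₁ α hα).mono hα hC₁.le (by linarith) e1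
  · exact (h₂ α hα).mono hα hC₂.le (by linarith) e2

theorem IsAdmissible.hasDerivWithinAt (h : IsAdmissible f x₀ β₁ β₂ ε δ T CT α θ) :
    ∀ t ∈ Icc 0 T, HasDerivWithinAt θ (derivWithin θ (Icc 0 T) t) (Icc 0 T) t := fun t ht =>
  ((h.smooth.differentiableOn (by norm_num)) t ht).hasDerivWithinAt

theorem IsAdmissible.hasDerivWithinAt_derivWithin (h : IsAdmissible f x₀ β₁ β₂ ε δ T CT α θ)
    (hT : 0 < T) : ∀ t ∈ Icc 0 T, HasDerivWithinAt (derivWithin θ (Icc 0 T))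
      (iteratedDerivWithin 2 θ (Icc 0 T) t) (Icc 0 T) t := fun t ht => by
  have := h.smooth.differentiableOn_iteratedDerivWithin (m := 1) (by norm_num)
    (uniqueDiffOn_Icc hT) t ht
  rw [iteratedDerivWithin_succ (n := 1), iteratedDerivWithin_one]
  rw [iteratedDerivWithin_one] at this
  exact this.hasDerivWithinAt

/-- Only the trivial kernel bound on `m` is needed to bound the forcing; this bounds the velocity,
hence the derivatives of `∇f ∘ θ` and of its squared norm, to which the averaging estimate then
applies. -/
theorem exists_isControlled (hf : ContDiff ℝ 4 f) (hS : IsCompact (sublevel f x₀))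
    (hβ₁ : 0 ≤ β₁) (hβ₁' : β₁ < 1) (hβ₂ : 0 ≤ β₂) (hβ₂' : β₂ < 1) (hε : 0 < ε) (hδ : 0 < δ)
    (CT : ℝ) (hδT : δ < T) :
    ∃ K > 0, ∀ α, 0 < α → α < δ → δ ≤ T - α → ∀ θ : ℝ → EuclideanSpace ℝ (Fin d),
      IsAdmissible f x₀ β₁ β₂ ε δ T CT α θ → IsControlled f α β₁ β₂ δ T K θ := by
  obtain ⟨C, hC, c, hc, hc2, hker⟩ := exists_common_memoryKernel hβ₁ hβ₁' hβ₂ hβ₂'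
  obtain ⟨G, hG, L, hL, R, hR, hSb⟩ := exists_gradient_bounds hf hS
  have hT : 0 < T := hδ.trans hδT
  have hβ₁p : 0 < 1 - β₁ := by linarith
  -- `B` bounds the forcing, `A/α` the initial spike of the velocity, `B'` the velocity without it,
  -- and `U` the velocity past `δ`. `K₁` and `K₂` are the averaging constants for the gradient and
  -- for its squared norm.
  set B := 1 / (ε * (1 - β₁)) * (C / c * G) with hB
  have hB0 : 0 < B := by positivity
  set A := Real.exp 2 * (8 * R + 6 * B * δ) with hA
  have hA0 : 0 < A := by positivity
  set B' := B + |CT| * δ with hB'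
  have hB'0 : 0 < B' := by positivity
  set U := A / (2 * δ) + B' with hU
  have hU0 : 0 < U := by positivity
  set K₁ := C * (G / (c * δ) + 2 * (L * A) / (c ^ 2 * δ)) + C * (L * B') / c with hK₁
  have hK₁0 : 0 < K₁ := by positivity
  set K₂ := C * (G ^ 2 / (c * δ) + 2 * (2 * G * L * A) / (c ^ 2 * δ)) +
    C * (2 * G * L * B') / c with hK₂
  have hK₂0 : 0 < K₂ := by positivity
  have hCG : 0 < C / c * G := by positivity
  have hCG2 : 0 < C / c * G ^ 2 := by positivity
  have hLU : 0 < L * U := by positivity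
  refine ⟨G + L * U + K₁ + K₂ + C / c * G + C / c * G ^ 2, by positivity,
    fun α hα hαδ hδTα θ hθ => ?_⟩
  set K := G + L * U + K₁ + K₂ + C / c * G + C / c * G ^ 2 with hK
  obtain ⟨k1, k2, k3, k4⟩ := hker α hα
  set u := derivWithin θ (Icc 0 T) with hu
  set a := iteratedDerivWithin 2 θ (Icc 0 T) with ha
  have du : ∀ t ∈ Icc 0 T, HasDerivWithinAt θ (u t) (Icc 0 T) t := hθ.hasDerivWithinAt
  have da : ∀ t ∈ Icc 0 T, HasDerivWithinAt u (a t) (Icc 0 T) t :=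
    hθ.hasDerivWithinAt_derivWithin hT
  have cu : ContinuousOn u (Icc 0 T) := fun t ht => (da t ht).continuousWithinAt
  have cθ : ContinuousOn θ (Icc 0 T) := fun t ht => (du t ht).continuousWithinAt
  have bG : ∀ t ∈ Icc 0 T, ‖gradient f (θ t)‖ ≤ G := fun t ht =>
    (hSb _ (hθ.mem_sublevel t ht)).1
  have bG2 : ∀ t ∈ Icc 0 T, ‖‖gradient f (θ t)‖ ^ 2‖ ≤ G ^ 2 := fun t ht => by
    rw [norm_pow, norm_norm]
    have := bG t ht
    gcongr
  have hsub : ∀ t ∈ Icc 0 T, Icc 0 t ⊆ Icc 0 T := fun t ht => Icc_subset_Icc_right ht.2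
  have bm : ∀ t ∈ Icc 0 T, ‖moment f α β₁ θ t‖ ≤ C / c * G := fun t ht =>
    norm_causalConv_le k3 hC hc hα ht.1 hG.le fun τ hτ => bG τ (hsub t ht hτ)
  have bF : ∀ t ∈ Icc 0 (T - α), ‖(α / 2) • a t + u t‖ ≤ B := by
    intro t ht
    rw [hθ.solves t ht, norm_neg, norm_smul, Real.norm_eq_abs,
      abs_of_nonneg (effective_scalar_nonneg hβ₁ hβ₁' hε hα (by linarith [ht.1]))]
    have h1 := effective_scalar_le (v := secondMoment f α β₂ θ (t + α)) hβ₁ hβ₁' hβ₂ hβ₂' hε hα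
      (by linarith [ht.1] : α ≤ t + α)
    have h2 := bm (t + α) ⟨by linarith [ht.1], by linarith [ht.2]⟩
    exact mul_le_mul h1 h2 (norm_nonneg _) (by positivity)
  have bu : ∀ t ∈ Icc 0 T, ‖u t‖ ≤ A / α * Real.exp (-(2 / α) * t) + B' := fun t ht =>
    norm_velocity_le hα hαδ hδTα hR.le (abs_nonneg CT) du da bF
      (fun t ht => (hSb _ (hθ.mem_sublevel t ht)).2.2)
      (fun t ht => (hθ.acc_bound t ht).trans (le_abs_self _)) ht
  have bu' : ∀ t ∈ Icc 0 T, ‖u t‖ ≤ A / α * Real.exp (-(c / α) * t) + B' := fun t ht => by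
    refine (bu t ht).trans ?_
    have : Real.exp (-(2 / α) * t) ≤ Real.exp (-(c / α) * t) := by
      apply Real.exp_le_exp.2
      have : c / α * t ≤ 2 / α * t := by
        have := ht.1
        gcongr
      linarith
    gcongr
  have bU : ∀ t ∈ Icc δ T, ‖u t‖ ≤ U := fun t ht => by
    have ht0 : 0 < t := hδ.trans_le ht.1
    refine (bu t ⟨ht0.le, ht.2⟩).trans ?_
    have h1 : Real.exp (-(2 / α) * t) ≤ 1 / (2 / α * t) := by
      rw [neg_mul]
      exact exp_neg_le_inv (by positivity)
    calc A / α * Real.exp (-(2 / α) * t) + B' ≤ A / α * (1 / (2 / α * t)) + B' := by gcongr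
      _ = A / (2 * t) + B' := by field_simp
      _ ≤ _ := by
        have := ht.1
        rw [hU]
        gcongr
  have hg := contDiff_gradient hf
  have dθ : ∀ t ∈ Ioo 0 T, HasDerivAt θ (u t) t := fun t ht =>
    (du t ⟨ht.1.le, ht.2.le⟩).hasDerivAt (Icc_mem_nhds ht.1 ht.2)
  set φ : ℝ → EuclideanSpace ℝ (Fin d) := fun t => gradient f (θ t) with hφ
  set φ' : ℝ → EuclideanSpace ℝ (Fin d) := fun t => fderiv ℝ (gradient f) (θ t) (u t) with hφ'
  have cφ : ContinuousOn φ (Icc 0 T) := hg.continuous.comp_continuousOn cθ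
  have cφ' : ContinuousOn φ' (Icc 0 T) :=
    ((hg.continuous_fderiv (by norm_num)).comp_continuousOn cθ).clm_apply cu
  have dφ : ∀ t ∈ Ioo 0 T, HasDerivAt φ (φ' t) t := fun t ht =>
    ((hg.differentiable (by norm_num) (θ t)).hasFDerivAt).comp_hasDerivAt t (dθ t ht)
  have bφ' : ∀ t ∈ Icc 0 T, ‖φ' t‖ ≤ L * ‖u t‖ := fun t ht =>
    ((fderiv ℝ (gradient f) (θ t)).le_opNorm (u t)).trans
      (mul_le_mul_of_nonneg_right (hSb _ (hθ.mem_sublevel t ht)).2.1 (norm_nonneg _))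
  have bφ'' : ∀ t ∈ Icc 0 T, ‖φ' t‖ ≤ L * A / α * Real.exp (-(c / α) * t) + L * B' :=
    fun t ht => by
      refine (bφ' t ht).trans ?_
      have := bu' t ht
      calc L * ‖u t‖ ≤ L * (A / α * Real.exp (-(c / α) * t) + B') := by gcongr
        _ = _ := by ring
  have bψ' : ∀ t ∈ Icc 0 T, ‖2 * inner ℝ (φ t) (φ' t)‖ ≤
      2 * G * L * A / α * Real.exp (-(c / α) * t) + 2 * G * L * B' := fun t ht => by
    rw [norm_mul, Real.norm_two]
    have h1 := norm_inner_le_norm (𝕜 := ℝ) (φ t) (φ' t)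
    have h2 := bφ'' t ht
    have h3 := bG t ht
    calc 2 * ‖inner ℝ (φ t) (φ' t)‖ ≤ 2 * (‖φ t‖ * ‖φ' t‖) := by gcongr
      _ ≤ 2 * (G * (L * A / α * Real.exp (-(c / α) * t) + L * B')) := by gcongr
      _ = _ := by ring
  have m0 : (0 : ℝ) ∈ Icc 0 T := ⟨le_rfl, hT.le⟩
  have hδs : Icc δ T ⊆ Icc 0 T := Icc_subset_Icc_left hδ.le
  have hconvφ : ∀ {H : ℝ → ℝ}, IsMemoryKernel C c α H → ∀ t ∈ Icc δ T,
      ‖causalConv H φ t - φ t‖ ≤ K₁ * α := fun hH t ht =>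
    norm_causalConv_sub_le_of_le hH hC hc hα hδ ht.1 (by positivity) (by positivity)
      (cφ.mono (hsub t (hδs ht))) (cφ'.mono (hsub t (hδs ht)))
      (fun τ hτ => dφ τ ⟨hτ.1, hτ.2.trans_le ht.2⟩) (bG 0 m0)
      (fun τ hτ => bφ'' τ (hsub t (hδs ht) hτ))
  have hconvψ : ∀ {H : ℝ → ℝ}, IsMemoryKernel C c α H → ∀ t ∈ Icc δ T,
      ‖causalConv H (fun τ => ‖φ τ‖ ^ 2) t - ‖φ t‖ ^ 2‖ ≤ K₂ * α := fun hH t ht =>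
    norm_causalConv_sub_le_of_le (φ := fun τ => ‖φ τ‖ ^ 2)
      (φ' := fun τ => 2 * inner ℝ (φ τ) (φ' τ)) hH hC hc hα hδ ht.1
      (by positivity) (by positivity) ((cφ.norm.pow 2).mono (hsub t (hδs ht)))
      ((continuousOn_const.mul (cφ.inner cφ')).mono (hsub t (hδs ht)))
      (fun τ hτ => (dφ τ ⟨hτ.1, hτ.2.trans_le ht.2⟩).norm_sq) (bG2 0 m0)
      (fun τ hτ => bψ' τ (hsub t (hδs ht) hτ))
  have eK₁ : K₁ * α ≤ K * α := by
    gcongr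
    linarith
  have eK₂ : K₂ * α ≤ K * α := by
    gcongr
    linarith
  exact
    { hasDerivAt := dθ
      continuousOn := cθ
      gradient_le := fun t ht => (bG t ht).trans (by linarith)
      gradient_lipschitz := fun s hs t ht => by
        have h1 := (convex_Icc δ T).norm_image_sub_le_of_norm_hasDerivWithin_le (f := φ)
          (f' := φ') (C := L * U) (s := Icc δ T) (x := s) (y := t) (fun x hx => by
            have h := (hg.differentiable (by norm_num) (θ x)).hasFDerivAt.comp_hasDerivWithinAt x
              (du x (hδs hx))
            exact h.mono hδs)
          (fun x hx => by
            refine (bφ' x (hδs hx)).trans ?_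
            have := bU x hx
            gcongr) hs ht
        rw [Real.norm_eq_abs] at h1
        refine h1.trans ?_
        gcongr
        linarith
      moment_sub := fun t ht => (hconvφ k3 t ht).trans eK₁
      momentOne_sub := fun t ht => (hconvφ k1 t ht).trans eK₁
      secondMomentOne_sub := fun t ht => (hconvψ k2 t ht).trans eK₂
      momentOne_le := fun t ht =>
        (norm_causalConv_le k1 hC hc hα ht.1 hG.le fun τ hτ => bG τ (hsub t ht hτ)).trans
          (by linarith)
      secondMoment_le := fun t ht =>
        (norm_causalConv_le k4 hC hc hα ht.1 (sq_nonneg G)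
          fun τ hτ => bG2 τ (hsub t ht hτ)).trans (by linarith)
      secondMomentOne_le := fun t ht =>
        (norm_causalConv_le k2 hC hc hα ht.1 (sq_nonneg G)
          fun τ hτ => bG2 τ (hsub t ht hτ)).trans (by linarith) }

end

/-! ### Pointwise dissipation, and the comparison of the two moments. -/

section

variable {d : ℕ} {f : EuclideanSpace ℝ (Fin d) → ℝ} {x₀ : EuclideanSpace ℝ (Fin d)}
  {β₁ β₂ ε δ T CT α K : ℝ} {θ : ℝ → EuclideanSpace ℝ (Fin d)}

theorem fStar_le (hf : Continuous f) (hS : IsCompact (sublevel f x₀))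
    {x : EuclideanSpace ℝ (Fin d)} (hx : x ∈ sublevel f x₀) : fStar f x₀ ≤ f x :=
  csInf_le (hS.image hf).bddBelow (mem_image_of_mem f hx)

theorem gap_nonneg (hf : Continuous f) (hS : IsCompact (sublevel f x₀))
    {x : EuclideanSpace ℝ (Fin d)} (hx : x ∈ sublevel f x₀) : 0 ≤ gap f x₀ x :=
  sub_nonneg.2 (fStar_le hf hS hx)

theorem gap_le {x : EuclideanSpace ℝ (Fin d)} (hx : x ∈ sublevel f x₀) :
    gap f x₀ x ≤ gap f x₀ x₀ :=
  sub_le_sub_right hx _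

theorem IsControlled.hasDerivAt_gap (h : IsControlled f α β₁ β₂ δ T K θ)
    (hf : Differentiable ℝ f) {t : ℝ} (ht : t ∈ Ioo 0 T) :
    HasDerivAt (fun t => gap f x₀ (θ t))
      (inner ℝ (gradient f (θ t)) (derivWithin θ (Icc 0 T) t)) t := by
  have h1 := (hf (θ t)).hasGradientAt.hasFDerivAt.comp_hasDerivAt t (h.hasDerivAt t ht)
  exact h1.sub_const (fStar f x₀)

/-- Pointwise dissipation: past `δ` the residual decreases at rate `κ ‖∇f‖²`, up to an error of
order `α²`. -/
theorem exists_inner_gradient_le (hβ₁ : 0 ≤ β₁) (hβ₁' : β₁ < 1) (hβ₂ : 0 ≤ β₂) (hβ₂' : β₂ < 1)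
    (hε : 0 < ε) (hδ : 0 < δ) (CT : ℝ) (hK : 0 < K) :
    ∃ κ > 0, ∃ C > 0, ∀ α, 0 < α → α < δ → ∀ θ : ℝ → EuclideanSpace ℝ (Fin d),
      IsAdmissible f x₀ β₁ β₂ ε δ T CT α θ → IsControlled f α β₁ β₂ δ T K θ →
      ∀ t ∈ Icc δ (T - α), inner ℝ (gradient f (θ t)) (derivWithin θ (Icc 0 T) t) ≤
        -κ * ‖gradient f (θ t)‖ ^ 2 + C * α ^ 2 := by
  have hβ₁p : 0 < 1 - β₁ := by linarith
  set κ := √(1 - β₂) / (√K + ε) with hκ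
  have hκ0 : 0 < κ := div_pos (Real.sqrt_pos.2 (by linarith)) (by positivity)
  -- One `K` is the averaging error at `t + α`, the other the change of the gradient from `t` to `t
  -- + α`; `|CT|/2` comes from the inertial term.
  set N := 1 / (ε * (1 - β₁)) * (2 * K) + |CT| / 2 with hN
  have hN0 : 0 < N := by positivity
  refine ⟨κ / 2, by positivity, N ^ 2 / (2 * κ), by positivity, fun α hα hαδ θ hθ hc t ht => ?_⟩
  have ht0 : 0 < t := hδ.trans_le ht.1
  have mt : t ∈ Icc δ T := ⟨ht.1, by linarith [ht.2]⟩
  have ms : t + α ∈ Icc δ T := ⟨by linarith [ht.1], by linarith [ht.2]⟩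
  set g := gradient f (θ t) with hg
  set s := biasEta α β₁ β₂ (t + α) /
    (√(secondMoment f α β₂ θ (t + α)) + biasEps α β₂ ε (t + α)) with hs
  have s1 : κ ≤ s := le_effective_scalar hβ₁ hβ₁' hβ₂ hβ₂' hε hα (by linarith)
    (le_of_abs_le (hc.secondMoment_le _ ⟨by linarith, ms.2⟩))
  have s2 : s ≤ 1 / (ε * (1 - β₁)) :=
    effective_scalar_le hβ₁ hβ₁' hβ₂ hβ₂' hε hα (by linarith)
  have s0 : 0 ≤ s := hκ0.le.trans s1
  have e1 : ‖moment f α β₁ θ (t + α) - g‖ ≤ 2 * K * α := by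
    have h1 := hc.moment_sub _ ms
    have h2 := hc.gradient_lipschitz _ mt _ ms
    rw [add_sub_cancel_left, abs_of_pos hα] at h2
    calc _ = ‖(moment f α β₁ θ (t + α) - gradient f (θ (t + α))) +
          (gradient f (θ (t + α)) - g)‖ := by rw [sub_add_sub_cancel]
      _ ≤ K * α + K * α := (norm_add_le _ _).trans (add_le_add h1 h2)
      _ = _ := by ring
  have hode := hθ.solves t ⟨ht0.le, ht.2⟩
  have e2 : ‖iteratedDerivWithin 2 θ (Icc 0 T) t‖ ≤ |CT| :=
    (hθ.acc_bound t ⟨by linarith [ht.1], mt.2⟩).trans (le_abs_self _)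
  have hu : derivWithin θ (Icc 0 T) t = -(s • g) + (-(s • (moment f α β₁ θ (t + α) - g)) -
      (α / 2) • iteratedDerivWithin 2 θ (Icc 0 T) t) := by
    rw [eq_sub_of_add_eq' hode, ← hs, smul_sub]
    abel
  set R := -(s • (moment f α β₁ θ (t + α) - g)) -
      (α / 2) • iteratedDerivWithin 2 θ (Icc 0 T) t with hR
  have bR : ‖R‖ ≤ N * α := by
    refine (norm_sub_le _ _).trans ?_
    rw [norm_neg, norm_smul, norm_smul, Real.norm_eq_abs, Real.norm_eq_abs, abs_of_nonneg s0,
      abs_of_pos (by positivity : 0 < α / 2)]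
    calc s * ‖moment f α β₁ θ (t + α) - g‖ + α / 2 * ‖iteratedDerivWithin 2 θ (Icc 0 T) t‖
        ≤ 1 / (ε * (1 - β₁)) * (2 * K * α) + α / 2 * |CT| := by gcongr
      _ = N * α := by rw [hN]; ring
  have h3 : inner ℝ g R ≤ ‖g‖ * (N * α) :=
    (real_inner_le_norm g R).trans (by gcongr)
  rw [hu, inner_add_right, inner_neg_right, real_inner_smul_right, real_inner_self_eq_norm_sq]
  have h4 : κ * ‖g‖ ^ 2 ≤ s * ‖g‖ ^ 2 := by gcongr
  -- Young's inequality turns the first-order error into one of order `α²`, at the price of half of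
  -- `κ`.
  have h5 : ‖g‖ * (N * α) ≤ κ / 2 * ‖g‖ ^ 2 + N ^ 2 / (2 * κ) * α ^ 2 := by
    have : κ / 2 * ‖g‖ ^ 2 + N ^ 2 / (2 * κ) * α ^ 2 - ‖g‖ * (N * α) =
        (κ * ‖g‖ - N * α) ^ 2 / (2 * κ) := by
      field_simp
      ring
    have : 0 ≤ (κ * ‖g‖ - N * α) ^ 2 / (2 * κ) := by positivity
    linarith
  linarith

theorem momentOne_zero : momentOne f α β₁ θ 0 = 0 := by simp [momentOne, causalConv]

theorem secondMomentOne_zero : secondMomentOne f α β₂ θ 0 = 0 := by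
  simp [secondMomentOne, causalConv]

/-- The first moment is controlled by the second one; this is where `β₁ ≤ √β₂` is used. -/
theorem norm_sq_momentOne_le (hβ₁' : β₁ < 1) (hβ₂ : 0 ≤ β₂) (hβ₂' : β₂ < 1) (hβ : β₁ ≤ √β₂)
    (hα : 0 < α) (hg : ContinuousOn (fun t => gradient f (θ t)) (Icc 0 T)) {t : ℝ}
    (ht : t ∈ Icc 0 T) :
    ‖momentOne f α β₁ θ t‖ ^ 2 ≤
      (1 - β₁) ^ 2 / ((1 - β₂) * (1 - 2 * β₁ + β₂)) * secondMomentOne f α β₂ θ t := by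
  have hT : 0 ≤ T := ht.1.trans ht.2
  -- By `β₁ ≤ √β₂` this is at least `(1 - √β₂)²`, which is positive since `β₂ < 1`.
  have hq : 0 < 1 - 2 * β₁ + β₂ := by
    have h1 := Real.sq_sqrt hβ₂
    have h2 : √β₂ < 1 := (Real.sqrt_lt' one_pos).2 (by linarith)
    nlinarith
  have hq₂ : 0 < 1 - β₂ := by linarith
  -- In terms of the rates, `Q = r₁² / (r₂ (2r₁ - r₂))`: the Cauchy–Schwarz constant `∫ H₁²/H₂` over
  -- `[0, ∞)`, which is finite exactly when `2r₁ > r₂`.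
  set Q := (1 - β₁) ^ 2 / ((1 - β₂) * (1 - 2 * β₁ + β₂)) with hQ
  set r₁ := rate α β₁ with hr₁
  set r₂ := rate α β₂ with hr₂
  set M := momentOne f α β₁ θ with hM
  set N := secondMomentOne f α β₂ θ with hN
  have cM : ContinuousOn M (Icc 0 T) := continuousOn_causalConv_kernelOne hg hT
  have cN : ContinuousOn N (Icc 0 T) := continuousOn_causalConv_kernelOne (hg.norm.pow 2) hT
  have dM : ∀ t ∈ Ioo 0 T, HasDerivAt M (r₁ • (gradient f (θ t) - M t)) t := fun t ht =>
    hasDerivAt_causalConv_kernelOne hg ht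
  have dN : ∀ t ∈ Ioo 0 T, HasDerivAt N (r₂ • (‖gradient f (θ t)‖ ^ 2 - N t)) t := fun t ht =>
    hasDerivAt_causalConv_kernelOne (hg.norm.pow 2) ht
  have he : ∀ t : ℝ, HasDerivAt (fun t => Real.exp (r₂ * t)) (r₂ * Real.exp (r₂ * t)) t :=
    fun t => by
      refine ((hasDerivAt_id t).const_mul r₂).exp.congr_deriv ?_
      simp only [id]
      ring
  -- With this weight, once the inner product is bounded by Cauchy–Schwarz, the derivative is at
  -- least a positive multiple of a quadratic form in `‖∇f‖` and `‖M‖`; the choice of `Q` makes this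
  -- form a perfect square.
  have hmono : MonotoneOn (fun t => Real.exp (r₂ * t) * (Q * N t - ‖M t‖ ^ 2)) (Icc 0 T) := by
    have hd : ∀ t ∈ Ioo 0 T, HasDerivAt (fun t => Real.exp (r₂ * t) * (Q * N t - ‖M t‖ ^ 2))
        (r₂ * Real.exp (r₂ * t) * (Q * N t - ‖M t‖ ^ 2) + Real.exp (r₂ * t) *
          (Q * (r₂ • (‖gradient f (θ t)‖ ^ 2 - N t)) -
            2 * inner ℝ (M t) (r₁ • (gradient f (θ t) - M t)))) t := fun t ht =>
      (he t).mul (((dN t ht).const_mul Q).sub (dM t ht).norm_sq)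
    refine monotoneOn_of_deriv_nonneg (convex_Icc 0 T) ?_ ?_ ?_
    · exact (Continuous.continuousOn (by fun_prop)).mul
        ((continuousOn_const.mul cN).sub (cM.norm.pow 2))
    · rw [interior_Icc]
      exact fun t ht => (hd t ht).differentiableAt.differentiableWithinAt
    · rw [interior_Icc]
      intro t ht
      rw [(hd t ht).deriv, smul_eq_mul, real_inner_smul_right, inner_sub_right,
        real_inner_self_eq_norm_sq]
      have h1 := real_inner_le_norm (M t) (gradient f (θ t))
      set x := ‖gradient f (θ t)‖
      set m := ‖M t‖
      set i := inner ℝ (M t) (gradient f (θ t))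
      have hr0 : 0 < r₁ := rate_pos hα hβ₁'
      have hD : 0 < 2 * r₁ - r₂ := by
        have : 2 * r₁ - r₂ = (1 - 2 * β₁ + β₂) / α := by
          rw [hr₁, hr₂, rate, rate]
          ring
        rw [this]
        positivity
      have hQr : Q * r₂ = r₁ ^ 2 / (2 * r₁ - r₂) := by
        have : 2 * r₁ - r₂ = (1 - 2 * β₁ + β₂) / α := by
          rw [hr₁, hr₂, rate, rate]
          ring
        rw [this, hQ, hr₁, hr₂, rate, rate]
        field_simp
      have h2 : 0 ≤ (r₁ * x - (2 * r₁ - r₂) * m) ^ 2 / (2 * r₁ - r₂) := by positivity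
      have h3 : (r₁ * x - (2 * r₁ - r₂) * m) ^ 2 / (2 * r₁ - r₂) =
          Q * r₂ * x ^ 2 - 2 * r₁ * (m * x) + (2 * r₁ - r₂) * m ^ 2 := by
        have : ∀ D : ℝ, D ≠ 0 → (r₁ * x - D * m) ^ 2 / D =
            r₁ ^ 2 / D * x ^ 2 - 2 * r₁ * (m * x) + D * m ^ 2 := fun D hD => by
          field_simp
          ring
        rw [hQr, this _ hD.ne']
      have h4 : r₁ * i ≤ r₁ * (m * x) := by gcongr
      have h5 : r₂ * Real.exp (r₂ * t) * (Q * N t - m ^ 2) + Real.exp (r₂ * t) *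
          (Q * (r₂ * (x ^ 2 - N t)) - 2 * (r₁ * (i - m ^ 2))) = Real.exp (r₂ * t) *
          (Q * r₂ * x ^ 2 - 2 * (r₁ * i) + (2 * r₁ - r₂) * m ^ 2) := by ring
      rw [h5]
      apply mul_nonneg (Real.exp_pos _).le
      linarith
  have h0 := hmono ⟨le_rfl, hT⟩ ht ht.1
  simp only [hM, hN, momentOne_zero, secondMomentOne_zero] at h0
  have h1 : 0 ≤ Real.exp (r₂ * t) * (Q * N t - ‖M t‖ ^ 2) := by simpa using h0
  have h2 := nonneg_of_mul_nonneg_right h1 (Real.exp_pos _)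
  linarith

theorem secondMomentOne_nonneg (hβ₂' : β₂ < 1) (hα : 0 < α) {t : ℝ} (ht : 0 ≤ t) :
    0 ≤ secondMomentOne f α β₂ θ t := by
  refine intervalIntegral.integral_nonneg ht fun τ _ => ?_
  have := rate_pos hα hβ₂'
  rw [kernelOne, smul_eq_mul]
  positivity

/-- The square root is not Lipschitz at zero, but `√w |√w - √w'| ≤ |w - w'|`. The hypothesis `p ≤ C
w` supplies this factor `√w`, with another `√w ≤ √B` to spare. -/
theorem div_sqrt_add_sub_le {p p' w w' C L B ε h : ℝ} (hp : 0 ≤ p) (hw : 0 ≤ w) (hw' : 0 ≤ w')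
    (hε : 0 < ε) (hC : 0 ≤ C) (hpw : p ≤ C * w) (hwB : w ≤ B) (hL : 0 ≤ L * h)
    (h1 : |p' - p| ≤ L * h) (h2 : |w' - w| ≤ L * h) :
    p' / (√w' + ε) - p / (√w + ε) ≤ (L / ε + C * √B * L / ε ^ 2) * h := by
  have a0 := Real.sqrt_nonneg w
  have b0 := Real.sqrt_nonneg w'
  have a2 := Real.sq_sqrt hw
  have b2 := Real.sq_sqrt hw'
  have aB : √w ≤ √B := Real.sqrt_le_sqrt hwB
  set a := √w
  set b := √w'
  have h3 : a * |a - b| ≤ L * h := by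
    refine le_trans ?_ h2
    rw [← a2, ← b2, abs_sub_comm, show b ^ 2 - a ^ 2 = (b + a) * (b - a) by ring, abs_mul,
      abs_of_nonneg (by positivity : 0 ≤ b + a)]
    gcongr
    linarith
  have h4 : p * |a - b| ≤ C * √B * (L * h) := by
    calc p * |a - b| ≤ C * w * |a - b| := by gcongr
      _ = C * a * (a * |a - b|) := by rw [← a2]; ring
      _ ≤ C * √B * (L * h) := by gcongr
  have e : p' / (b + ε) - p / (a + ε) =
      (p' - p) / (b + ε) + p * (a - b) / ((a + ε) * (b + ε)) := by
    field_simp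
    ring
  have e1 : (p' - p) / (b + ε) ≤ L * h / ε := by
    calc (p' - p) / (b + ε) ≤ L * h / (b + ε) := by
          gcongr
          exact (le_abs_self _).trans h1
      _ ≤ _ := by
          gcongr
          linarith
  have e2 : p * (a - b) / ((a + ε) * (b + ε)) ≤ C * √B * (L * h) / ε ^ 2 := by
    calc p * (a - b) / ((a + ε) * (b + ε)) ≤ C * √B * (L * h) / ((a + ε) * (b + ε)) := by
          refine div_le_div_of_nonneg_right ?_ (by positivity)
          exact (mul_le_mul_of_nonneg_left (le_abs_self _) hp).trans h4
      _ ≤ _ := by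
          gcongr
          nlinarith
  rw [e]
  calc _ ≤ L * h / ε + C * √B * (L * h) / ε ^ 2 := add_le_add e1 e2
    _ = _ := by ring

theorem abs_div_one_sub_sub_le {x x' b b' β B D h : ℝ} (hβ : β < 1) (hb : b ≤ β) (hb' : b' ≤ β)
    (hx : |x| ≤ B) (hxx : |x' - x| ≤ D) (hbb : |b' - b| ≤ h) :
    |x' / (1 - b') - x / (1 - b)| ≤ D / (1 - β) + B * h / (1 - β) ^ 2 := by
  have p : 0 < 1 - b := by linarith
  have p' : 0 < 1 - b' := by linarith
  have q : 0 < 1 - β := by linarith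
  have e : x' / (1 - b') - x / (1 - b) =
      (x' - x) / (1 - b') + x * (b' - b) / ((1 - b') * (1 - b)) := by
    field_simp
    ring
  have hB : 0 ≤ B := (abs_nonneg _).trans hx
  have hD : 0 ≤ D := (abs_nonneg _).trans hxx
  have hh : 0 ≤ h := (abs_nonneg _).trans hbb
  rw [e]
  refine (abs_add_le _ _).trans (add_le_add ?_ ?_)
  · rw [abs_div, abs_of_pos p']
    gcongr
  · rw [abs_div, abs_mul, abs_of_pos (mul_pos p' p), sq]
    gcongr

end

/-! ### Scalar differential inequalities and the KL rate function. -/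

section Rates

variable {a b : ℝ}

theorem antitoneOn_of_hasDerivAt_nonpos {h h' : ℝ → ℝ}
    (hd : ∀ t ∈ Icc a b, HasDerivAt h (h' t) t) (hn : ∀ t ∈ Icc a b, h' t ≤ 0) :
    AntitoneOn h (Icc a b) := by
  refine antitoneOn_of_deriv_nonpos (convex_Icc a b)
    (fun t ht => (hd t ht).continuousAt.continuousWithinAt)
    (fun t ht => (hd t (interior_subset ht)).differentiableAt.differentiableWithinAt) fun t ht => ?_
  rw [(hd t (interior_subset ht)).deriv]
  exact hn t (interior_subset ht)

theorem hasDerivAt_exp_const_mul (k t : ℝ) :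
    HasDerivAt (fun t => Real.exp (k * t)) (k * Real.exp (k * t)) t := by
  refine ((hasDerivAt_id t).const_mul k).exp.congr_deriv ?_
  simp only [id]
  ring

/-- Exponential decay up to a constant forcing. -/
theorem le_exp_add_of_deriv_le {Φ Φ' : ℝ → ℝ} {ω E : ℝ} (hω : 0 < ω) (hE : 0 ≤ E)
    (hd : ∀ t ∈ Icc a b, HasDerivAt Φ (Φ' t) t)
    (hn : ∀ t ∈ Icc a b, Φ' t ≤ -ω * Φ t + E) {t : ℝ} (ht : t ∈ Icc a b) :
    Φ t ≤ Φ a * Real.exp (-ω * (t - a)) + E / ω := by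
  have hanti : AntitoneOn (fun t => Real.exp (ω * t) * (Φ t - E / ω)) (Icc a b) := by
    refine antitoneOn_of_hasDerivAt_nonpos
      (fun t ht => (hasDerivAt_exp_const_mul ω t).mul ((hd t ht).sub_const _)) fun t ht => ?_
    have h1 := hn t ht
    have h2 : ω * Real.exp (ω * t) * (Φ t - E / ω) + Real.exp (ω * t) * Φ' t =
        Real.exp (ω * t) * (Φ' t - (-ω * Φ t + E)) := by
      field_simp
      ring
    rw [h2]
    exact mul_nonpos_of_nonneg_of_nonpos (Real.exp_pos _).le (by linarith)
  have h1 := hanti ⟨le_rfl, ht.1.trans ht.2⟩ ht ht.1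
  simp only at h1
  have h2 : Real.exp (-ω * (t - a)) * Real.exp (ω * t) = Real.exp (ω * a) := by
    rw [← Real.exp_add]
    ring_nf
  have h3 : Φ t - E / ω ≤ Real.exp (-ω * (t - a)) * (Φ a - E / ω) := by
    rw [← h2] at h1
    refine le_of_mul_le_mul_left (h1.trans_eq ?_) (Real.exp_pos (ω * t))
    ring
  have h4 : 0 ≤ Real.exp (-ω * (t - a)) * (E / ω) := by positivity
  linarith

/-- In the form on the right, `y` occurs once, so monotonicity in `y` can be read off and the
integrated inequality for `D ^ (-q)` matches. -/
theorem mul_one_add_rpow {y c q : ℝ} (hy : 0 < y) (hc : 0 ≤ c) (hq : 0 < q) :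
    y * (1 + c * y ^ q) ^ (-1 / q) = (y ^ (-q) + c) ^ (-1 / q) := by
  have h1 : y ^ (-q) + c = y ^ (-q) * (1 + c * y ^ q) := by
    rw [mul_add, mul_one, mul_left_comm, ← Real.rpow_add hy]
    simp
  rw [h1, Real.mul_rpow (by positivity) (by positivity), ← Real.rpow_mul hy.le]
  congr 1
  rw [show -q * (-1 / q) = 1 by field_simp, Real.rpow_one]

theorem klRate_nonneg {σ k y s : ℝ} (hk : 0 < k) (hy : 0 ≤ y) (hs : 0 ≤ s) :
    0 ≤ klRate σ k y s := by
  unfold klRate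
  split_ifs with h1 h2
  · positivity
  · positivity
  · have : 0 ≤ 2 * σ - 1 := by linarith [not_lt.1 h1]
    positivity

theorem klRate_mono {σ k y y' s : ℝ} (hk : 0 < k) (hy : 0 ≤ y) (hyy : y ≤ y') (hs : 0 ≤ s) :
    klRate σ k y s ≤ klRate σ k y' s := by
  rcases hy.eq_or_lt with rfl | hy0
  · refine le_trans ?_ (klRate_nonneg hk hyy hs)
    unfold klRate
    split_ifs with h1 h2
    · have : 0 < 1 - 2 * σ := by linarith
      rw [Real.zero_rpow this.ne', max_eq_left (by have : 0 ≤ (1 - 2 * σ) * k * s := by positivity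
                                                   linarith), Real.zero_rpow (by positivity)]
    · simp
    · simp
  unfold klRate
  split_ifs with h1 h2
  · have : 0 < 1 - 2 * σ := by linarith
    gcongr
  · gcongr
  · have hq : 0 < 2 * σ - 1 := by
      rcases lt_or_eq_of_le (not_lt.1 h1) with h | h
      · linarith
      · exact absurd h.symm h2
    set q := 2 * σ - 1
    have e : ∀ y, q * k * y ^ q * s = (q * k * s) * y ^ q := fun y => by ring
    rw [e, e, mul_one_add_rpow hy0 (by positivity) hq,
      mul_one_add_rpow (hy0.trans_le hyy) (by positivity) hq]
    have hy' : 0 < y' := hy0.trans_le hyy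
    refine Real.rpow_le_rpow_of_nonpos (by positivity) ?_ ?_
    · have := Real.rpow_le_rpow_of_nonpos hy0 hyy (by linarith : -q ≤ 0)
      linarith
    · rw [neg_div]
      simp only [Left.neg_nonpos_iff]
      positivity

/-- A positive solution of `D' ≤ -k D^{2σ}` is dominated by the KL rate function. -/
theorem le_klRate_of_deriv_le {D D' : ℝ → ℝ} {σ k : ℝ} (hk : 0 < k) (hab : a ≤ b)
    (hpos : ∀ t ∈ Icc a b, 0 < D t) (hd : ∀ t ∈ Icc a b, HasDerivAt D (D' t) t)
    (hn : ∀ t ∈ Icc a b, D' t ≤ -k * D t ^ (2 * σ)) : D b ≤ klRate σ k (D a) (b - a) := by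
  have ma : a ∈ Icc a b := ⟨le_rfl, hab⟩
  have mb : b ∈ Icc a b := ⟨hab, le_rfl⟩
  unfold klRate
  split_ifs with h1 h2
  · set q := 1 - 2 * σ with hq
    have hq0 : 0 < q := by linarith
    -- Separation of variables: `(D^{1-2σ})' ≤ -(1-2σ) k`. For `σ > 1/2` the exponent is negative
    -- and the sign flips.
    have hanti : AntitoneOn (fun t => D t ^ q + q * k * t) (Icc a b) := by
      refine antitoneOn_of_hasDerivAt_nonpos (fun t ht =>
        ((hd t ht).rpow_const (Or.inl (hpos t ht).ne')).add
          ((hasDerivAt_id t).const_mul (q * k))) fun t ht => ?_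
      have hp := hpos t ht
      have e : D t ^ (2 * σ) * D t ^ (q - 1) = 1 := by
        rw [← Real.rpow_add hp, hq]
        ring_nf
        simp
      have h3 : D' t * (q * D t ^ (q - 1)) ≤ -k * D t ^ (2 * σ) * (q * D t ^ (q - 1)) :=
        mul_le_mul_of_nonneg_right (hn t ht) (by positivity)
      have h4 : -k * D t ^ (2 * σ) * (q * D t ^ (q - 1)) =
        -(k * q) * (D t ^ (2 * σ) * D t ^ (q - 1)) := by ring
      rw [h4, e] at h3
      linarith
    have h3 := hanti ma mb hab
    simp only at h3
    have h4 : D b ^ q ≤ max 0 (D a ^ q - q * k * (b - a)) :=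
      le_max_of_le_right (by linarith)
    calc D b = (D b ^ q) ^ (1 / q) := by
          rw [← Real.rpow_mul (hpos b mb).le, mul_one_div_cancel hq0.ne', Real.rpow_one]
      _ ≤ _ := Real.rpow_le_rpow (Real.rpow_nonneg (hpos b mb).le _) h4 (by positivity)
  · have := le_exp_add_of_deriv_le (E := 0) hk le_rfl hd (fun t ht => by
      have := hn t ht
      rw [h2, mul_one_div_cancel two_ne_zero, Real.rpow_one] at this
      linarith) mb
    simpa using this
  · have hq0 : 0 < 2 * σ - 1 := by
      rcases lt_or_eq_of_le (not_lt.1 h1) with h | h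
      · linarith
      · exact absurd h.symm h2
    set q := 2 * σ - 1 with hq
    have hanti : AntitoneOn (fun t => q * k * t - D t ^ (-q)) (Icc a b) := by
      refine antitoneOn_of_hasDerivAt_nonpos (fun t ht =>
        ((hasDerivAt_id t).const_mul (q * k)).sub
          ((hd t ht).rpow_const (p := -q) (Or.inl (hpos t ht).ne'))) fun t ht => ?_
      have hp := hpos t ht
      have e : D t ^ (2 * σ) * D t ^ (-q - 1) = 1 := by
        rw [← Real.rpow_add hp, hq]
        ring_nf
        simp
      have h3 : D' t * (q * D t ^ (-q - 1)) ≤ -k * D t ^ (2 * σ) * (q * D t ^ (-q - 1)) :=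
        mul_le_mul_of_nonneg_right (hn t ht) (by positivity)
      have h4 : -k * D t ^ (2 * σ) * (q * D t ^ (-q - 1)) =
        -(k * q) * (D t ^ (2 * σ) * D t ^ (-q - 1)) := by ring
      rw [h4, e] at h3
      linarith
    have h3 := hanti ma mb hab
    simp only at h3
    have hs : 0 ≤ b - a := by linarith
    rw [show q * k * D a ^ q * (b - a) = (q * k * (b - a)) * D a ^ q by ring,
      mul_one_add_rpow (hpos a ma) (by positivity) hq0]
    have ha := hpos a ma
    have e : -1 / q ≤ 0 := by
      rw [neg_div]
      simp only [Left.neg_nonpos_iff]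
      positivity
    calc D b = (D b ^ (-q)) ^ (-1 / q) := by
          rw [← Real.rpow_mul (hpos b mb).le, show -q * (-1 / q) = 1 by field_simp,
            Real.rpow_one]
      _ ≤ _ := Real.rpow_le_rpow_of_nonpos (by positivity) (by linarith) e

/-- Decay at the KL rate, up to the level at which the forcing balances the dissipation. -/
theorem le_klRate_add_of_deriv_le {Φ Φ' : ℝ → ℝ} {σ k r E : ℝ} (hσ : 0 < σ) (hk : 0 < k)
    (hr : 0 < r) (hE : E ≤ k * r ^ (2 * σ)) (h0 : ∀ t ∈ Icc a b, 0 ≤ Φ t)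
    (hd : ∀ t ∈ Icc a b, HasDerivAt Φ (Φ' t) t)
    (hn : ∀ t ∈ Icc a b, Φ' t ≤ -(2 * k) * Φ t ^ (2 * σ) + E) {t : ℝ} (ht : t ∈ Icc a b) :
    Φ t ≤ klRate σ k (Φ a) (t - a) + r := by
  have ma : a ∈ Icc a b := ⟨le_rfl, ht.1.trans ht.2⟩
  have hta : 0 ≤ t - a := sub_nonneg.2 ht.1
  rcases le_or_gt (Φ t) r with h | h
  · linarith [klRate_nonneg (σ := σ) hk (h0 a ma) hta]
  -- The level `r` is a barrier: where `Φ = r`, the derivative is at most `-2k r^{2σ} + E < 0`, so a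
  -- trajectory above `r` at time `t` was above it throughout.
  have hgt : ∀ s ∈ Icc a t, r < Φ s := by
    intro s hs
    by_contra! hle
    have hsub : Icc s t ⊆ Icc a b := Icc_subset_Icc hs.1 ht.2
    refine absurd h (not_lt.2 ?_)
    refine image_le_of_deriv_right_lt_deriv_boundary (f := Φ) (f' := Φ') (B := fun _ => r)
      (B' := fun _ => 0) (fun x hx => (hd x (hsub hx)).continuousAt.continuousWithinAt)
      (fun x hx => (hd x (hsub ⟨hx.1, hx.2.le⟩)).hasDerivWithinAt) hle
      (fun x => hasDerivAt_const x r) (fun x hx hxr => ?_) ⟨hs.2, le_rfl⟩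
    have h1 := hn x (hsub ⟨hx.1, hx.2.le⟩)
    rw [hxr] at h1
    have : 0 < k * r ^ (2 * σ) := by positivity
    linarith
  have hsub : Icc a t ⊆ Icc a b := Icc_subset_Icc_right ht.2
  -- Above `r`, half of the dissipation absorbs `E`, and the other half drives `Φ - r`, which is
  -- positive as the comparison requires.
  have h1 := le_klRate_of_deriv_le (D := fun s => Φ s - r) (D' := Φ') (σ := σ) hk ht.1
    (fun s hs => sub_pos.2 (hgt s hs)) (fun s hs => (hd s (hsub hs)).sub_const r) fun s hs => by
      have h2 := hn s (hsub hs)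
      have h3 := hgt s hs
      have h4 : r ^ (2 * σ) ≤ Φ s ^ (2 * σ) := Real.rpow_le_rpow hr.le h3.le (by positivity)
      have h5 : (Φ s - r) ^ (2 * σ) ≤ Φ s ^ (2 * σ) :=
        Real.rpow_le_rpow (by linarith) (by linarith) (by positivity)
      nlinarith
  have h2 := klRate_mono (σ := σ) hk (sub_pos.2 (hgt a ⟨le_rfl, ht.1⟩)).le
    (by linarith : Φ a - r ≤ Φ a) hta
  linarith

end Rates

/-! ### Global KL, the kinetic term, and the estimates for the three items. -/

section

variable {d : ℕ} {f : EuclideanSpace ℝ (Fin d) → ℝ} {x₀ : EuclideanSpace ℝ (Fin d)}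
  {β₁ β₂ ε δ T CT α K : ℝ} {θ : ℝ → EuclideanSpace ℝ (Fin d)}

/-- On a compact sublevel set the KL inequality near the critical points holds globally. -/
theorem KLInequality.exists_global {σ : ℝ} (hf : ContDiff ℝ 4 f) (hS : IsCompact (sublevel f x₀))
    (hσ : 0 < σ) (h : KLInequality f x₀ σ) :
    ∃ c > 0, ∀ x ∈ sublevel f x₀, c * gap f x₀ x ^ σ ≤ ‖gradient f x‖ := by
  obtain ⟨c, hc, U, hU, hcrit, hKL⟩ := h
  have hg : Continuous fun x => ‖gradient f x‖ := (contDiff_gradient hf).continuous.norm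
  have hle : ∀ x ∈ sublevel f x₀, gap f x₀ x ^ σ ≤ gap f x₀ x₀ ^ σ := fun x hx =>
    Real.rpow_le_rpow (gap_nonneg hf.continuous hS hx) (gap_le hx) hσ.le
  have h0 : 0 ≤ gap f x₀ x₀ ^ σ :=
    Real.rpow_nonneg (gap_nonneg hf.continuous hS (le_refl (f x₀))) _
  rcases (sublevel f x₀ \ U).eq_empty_or_nonempty with he | hne
  · exact ⟨c, hc, fun x hx => hKL x ⟨hx, sdiff_eq_empty.1 he hx⟩⟩
  obtain ⟨z, hz, hmin⟩ := (hS.diff hU).exists_isMinOn hne hg.continuousOn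
  have hz0 : 0 < ‖gradient f z‖ :=
    norm_pos_iff.2 fun h => hz.2 (hcrit ⟨hz.1, h⟩)
  -- Off `U` the gradient norm has a positive minimum and the gap is at most its value at `x₀`; the
  -- `+ 1` guards against a zero denominator.
  refine ⟨min c (‖gradient f z‖ / (gap f x₀ x₀ ^ σ + 1)), lt_min hc (by positivity),
    fun x hx => ?_⟩
  have hx0 : 0 ≤ gap f x₀ x ^ σ := Real.rpow_nonneg (gap_nonneg hf.continuous hS hx) _
  by_cases hxU : x ∈ U
  · exact (mul_le_mul_of_nonneg_right (min_le_left _ _) hx0).trans (hKL x ⟨hx, hxU⟩)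
  · calc _ ≤ ‖gradient f z‖ / (gap f x₀ x₀ ^ σ + 1) * (gap f x₀ x₀ ^ σ + 1) := by
          gcongr
          · exact min_le_right _ _
          · linarith [hle x hx]
      _ = ‖gradient f z‖ := by field_simp
      _ ≤ _ := hmin ⟨hx, hxU⟩

/-- Strong convexity is used at the midpoint of `x` and `z` only, where `f` is at least `f z`. This
gives `μ/4` in place of the optimal `μ/2`. -/
theorem norm_sq_sub_le_of_strongConvexOn {μ : ℝ} (hf : Continuous f)
    (hS : IsCompact (sublevel f x₀)) (h : StrongConvexOn (sublevel f x₀) μ f)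
    {z : EuclideanSpace ℝ (Fin d)} (hz : z ∈ sublevel f x₀) (hmin : IsMinOn f (sublevel f x₀) z)
    {x : EuclideanSpace ℝ (Fin d)} (hx : x ∈ sublevel f x₀) :
    μ / 4 * ‖x - z‖ ^ 2 ≤ gap f x₀ x := by
  have h1 := h.2 hx hz (by norm_num : (0 : ℝ) ≤ 1 / 2) (by norm_num : (0 : ℝ) ≤ 1 / 2)
    (by norm_num)
  have h2 : f z ≤ f ((1 / 2 : ℝ) • x + (1 / 2 : ℝ) • z) :=
    hmin (h.1 hx hz (by norm_num) (by norm_num) (by norm_num))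
  have h3 := fStar_le hf hS hz
  simp only [smul_eq_mul] at h1
  rw [gap]
  linarith

/-- Past `δ` the large rate in `M₁' = λ₁ (∇f - M₁)` meets a difference of order `α`, so `M₁` is
Lipschitz uniformly in `α`; so is the bias correction. -/
theorem norm_sq_momentOne_div_sub_le {a b : ℝ} (hβ₁ : 0 ≤ β₁) (hβ₁' : β₁ < 1) (hα : 0 < α)
    (hδ : 0 < δ) (hK : 0 < K) (hc : IsControlled f α β₁ β₂ δ T K θ)
    (hg : ContinuousOn (fun t => gradient f (θ t)) (Icc 0 T)) (ha : δ ≤ a) (hab : a ≤ b)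
    (hb : b < T) (hαa : α ≤ a) :
    |‖momentOne f α β₁ θ b‖ ^ 2 / (1 - β₁ ^ (b / α)) -
      ‖momentOne f α β₁ θ a‖ ^ 2 / (1 - β₁ ^ (a / α))| ≤
        (2 * K ^ 2 / (1 - β₁) + K ^ 2 / (δ * (1 - β₁) ^ 2)) * (b - a) := by
  have hx : ∀ t ∈ Icc a b, t ∈ Ioo 0 T ∧ t ∈ Icc δ T := fun t ht =>
    ⟨⟨by linarith [ht.1], ht.2.trans_lt hb⟩, ⟨ha.trans ht.1, ht.2.trans hb.le⟩⟩
  have ma : a ∈ Icc a b := ⟨le_rfl, hab⟩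
  have mb : b ∈ Icc a b := ⟨hab, le_rfl⟩
  have h1 : ‖momentOne f α β₁ θ b - momentOne f α β₁ θ a‖ ≤ K * ‖b - a‖ := by
    refine (convex_Icc a b).norm_image_sub_le_of_norm_hasDerivWithin_le
      (fun t ht => (hasDerivAt_causalConv_kernelOne hg (hx t ht).1).hasDerivWithinAt)
      (fun t ht => ?_) ma mb
    have := hc.momentOne_sub t (hx t ht).2
    rw [norm_smul, norm_sub_rev, Real.norm_eq_abs, abs_of_pos (rate_pos hα hβ₁'), rate]
    calc _ ≤ (1 - β₁) / α * (K * α) := by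
          gcongr
          exact this
      _ = (1 - β₁) * K := by field_simp
      _ ≤ K := by nlinarith
  rw [Real.norm_eq_abs, abs_of_nonneg (by linarith)] at h1
  have k1 := hc.momentOne_le a (Ioo_subset_Icc_self (hx a ma).1)
  have k2 := hc.momentOne_le b (Ioo_subset_Icc_self (hx b mb).1)
  have h2 : |‖momentOne f α β₁ θ b‖ ^ 2 - ‖momentOne f α β₁ θ a‖ ^ 2| ≤ 2 * K ^ 2 * (b - a) := by
    have h3 := (abs_norm_sub_norm_le (momentOne f α β₁ θ b) (momentOne f α β₁ θ a)).trans h1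
    rw [sq_sub_sq, abs_mul, abs_of_nonneg (by positivity)]
    calc _ ≤ (K + K) * (K * (b - a)) := by gcongr
      _ = _ := by ring
  have h3 : |‖momentOne f α β₁ θ a‖ ^ 2| ≤ K ^ 2 := by
    rw [abs_of_nonneg (by positivity)]
    gcongr
  refine (abs_div_one_sub_sub_le hβ₁' (rpow_mem_of_one_le hβ₁ hβ₁' ((one_le_div hα).2 hαa)).2
    (rpow_mem_of_one_le hβ₁ hβ₁' ((one_le_div hα).2 (hαa.trans hab))).2 h3 h2
    (abs_rpow_div_sub_le hβ₁ hβ₁' hα hδ ha hab)).trans_eq ?_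
  have : 1 - β₁ ≠ 0 := by linarith
  field_simp

theorem secondMomentOne_div_sub_le {a b : ℝ} (hβ₂ : 0 ≤ β₂) (hβ₂' : β₂ < 1) (hα : 0 < α)
    (hδ : 0 < δ) (hK : 0 < K) (hc : IsControlled f α β₁ β₂ δ T K θ)
    (hg : ContinuousOn (fun t => gradient f (θ t)) (Icc 0 T)) (ha : δ ≤ a) (hab : a ≤ b)
    (hb : b < T) (hαa : α ≤ a) :
    |secondMomentOne f α β₂ θ b / (1 - β₂ ^ (b / α)) -
      secondMomentOne f α β₂ θ a / (1 - β₂ ^ (a / α))| ≤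
        (K / (1 - β₂) + K / (δ * (1 - β₂) ^ 2)) * (b - a) := by
  have hx : ∀ t ∈ Icc a b, t ∈ Ioo 0 T ∧ t ∈ Icc δ T := fun t ht =>
    ⟨⟨by linarith [ht.1], ht.2.trans_lt hb⟩, ⟨ha.trans ht.1, ht.2.trans hb.le⟩⟩
  have ma : a ∈ Icc a b := ⟨le_rfl, hab⟩
  have mb : b ∈ Icc a b := ⟨hab, le_rfl⟩
  have h1 : ‖secondMomentOne f α β₂ θ b - secondMomentOne f α β₂ θ a‖ ≤ K * ‖b - a‖ := by
    refine (convex_Icc a b).norm_image_sub_le_of_norm_hasDerivWithin_le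
      (fun t ht => (hasDerivAt_causalConv_kernelOne (hg.norm.pow 2) (hx t ht).1).hasDerivWithinAt)
      (fun t ht => ?_) ma mb
    have := hc.secondMomentOne_sub t (hx t ht).2
    rw [norm_smul, norm_sub_rev, Real.norm_eq_abs, abs_of_pos (rate_pos hα hβ₂'), rate]
    calc _ ≤ (1 - β₂) / α * (K * α) := by
          gcongr
          exact this
      _ = (1 - β₂) * K := by field_simp
      _ ≤ K := by nlinarith
  rw [Real.norm_eq_abs, Real.norm_eq_abs, abs_of_nonneg (by linarith : 0 ≤ b - a)] at h1
  refine (abs_div_one_sub_sub_le hβ₂' (rpow_mem_of_one_le hβ₂ hβ₂' ((one_le_div hα).2 hαa)).2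
    (rpow_mem_of_one_le hβ₂ hβ₂' ((one_le_div hα).2 (hαa.trans hab))).2
    (hc.secondMomentOne_le a (Ioo_subset_Icc_self (hx a ma).1)) h1
    (abs_rpow_div_sub_le hβ₂ hβ₂' hα hδ ha hab)).trans_eq ?_
  have : 1 - β₂ ≠ 0 := by linarith
  field_simp

/-- The kinetic part of the Lyapunov functional varies by `O(α)` per unit of time. -/
theorem exists_kinetic_sub_le (hβ₁ : 0 ≤ β₁) (hβ₁' : β₁ < 1) (hβ₂ : 0 ≤ β₂) (hβ₂' : β₂ < 1)
    (hβ : β₁ ≤ √β₂) (hε : 0 < ε) (hδ : 0 < δ) (hK : 0 < K) :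
    ∃ C > 0, ∀ α, 0 < α → ∀ θ : ℝ → EuclideanSpace ℝ (Fin d),
      IsControlled f α β₁ β₂ δ T K θ → ContinuousOn (fun t => gradient f (θ t)) (Icc 0 T) →
      ∀ a b, δ ≤ a → a ≤ b → b < T → α ≤ a →
        effScalar f α β₁ β₂ ε θ b / (2 * rate α β₁) * ‖momentOne f α β₁ θ b‖ ^ 2 -
          effScalar f α β₁ β₂ ε θ a / (2 * rate α β₁) * ‖momentOne f α β₁ θ a‖ ^ 2 ≤
        C * α * (b - a) := by
  have p₁ : 0 < 1 - β₁ := by linarith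
  have p₂ : 0 < 1 - β₂ := by linarith
  have hq : 0 < 1 - 2 * β₁ + β₂ := by
    have h1 := Real.sq_sqrt hβ₂
    have h2 : √β₂ < 1 := (Real.sqrt_lt' one_pos).2 (by linarith)
    nlinarith
  set L := (2 * K ^ 2 / (1 - β₁) + K ^ 2 / (δ * (1 - β₁) ^ 2)) +
    (K / (1 - β₂) + K / (δ * (1 - β₂) ^ 2)) with hL
  have hL1 : 0 < 2 * K ^ 2 / (1 - β₁) + K ^ 2 / (δ * (1 - β₁) ^ 2) := by positivity
  have hL2 : 0 < K / (1 - β₂) + K / (δ * (1 - β₂) ^ 2) := by positivity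
  have hL0 : 0 < L := by positivity
  set Q := (1 - β₁) ^ 2 / ((1 - β₂) * (1 - 2 * β₁ + β₂)) with hQ
  have hQ0 : 0 < Q := by positivity
  set B := K / (1 - β₂) with hB
  set N := L / ε + Q / (1 - β₁) * √B * L / ε ^ 2 with hN
  have hN0 : 0 < N := by positivity
  refine ⟨N / (2 * (1 - β₁)), by positivity, fun α hα θ hc hg a b ha hab hb hαa => ?_⟩
  have ha0 : 0 < a := hδ.trans_le ha
  have b₁ : ∀ t, α ≤ t → 0 < 1 - β₁ ^ (t / α) ∧ 1 - β₁ ≤ 1 - β₁ ^ (t / α) := fun t ht => by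
    have := (rpow_mem_of_one_le hβ₁ hβ₁' ((one_le_div hα).2 ht)).2
    exact ⟨by linarith, by linarith⟩
  have b₂ : ∀ t, α ≤ t → 0 < 1 - β₂ ^ (t / α) ∧ 1 - β₂ ≤ 1 - β₂ ^ (t / α) ∧
      1 - β₂ ^ (t / α) ≤ 1 := fun t ht => by
    have := rpow_mem_of_one_le hβ₂ hβ₂' ((one_le_div hα).2 ht)
    exact ⟨by linarith [this.2], by linarith [this.2], by linarith [this.1]⟩
  have ma : a ∈ Icc 0 T := ⟨ha0.le, by linarith⟩
  have hba : 0 ≤ b - a := by linarith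
  have n0 : ∀ t, 0 ≤ t → 0 ≤ secondMomentOne f α β₂ θ t := fun t ht =>
    secondMomentOne_nonneg hβ₂' hα ht
  have key := div_sqrt_add_sub_le
    (p := ‖momentOne f α β₁ θ a‖ ^ 2 / (1 - β₁ ^ (a / α)))
    (p' := ‖momentOne f α β₁ θ b‖ ^ 2 / (1 - β₁ ^ (b / α)))
    (w := secondMomentOne f α β₂ θ a / (1 - β₂ ^ (a / α)))
    (w' := secondMomentOne f α β₂ θ b / (1 - β₂ ^ (b / α)))
    (C := Q / (1 - β₁)) (L := L) (B := B) (ε := ε) (h := b - a)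
    (div_nonneg (sq_nonneg _) (b₁ a hαa).1.le)
    (div_nonneg (n0 a ha0.le) (b₂ a hαa).1.le)
    (div_nonneg (n0 b (ha0.le.trans hab)) (b₂ b (hαa.trans hab)).1.le) hε (by positivity)
    (by
      have h1 := norm_sq_momentOne_le hβ₁' hβ₂ hβ₂' hβ hα hg ma
      have h2 := n0 a ha0.le
      calc _ ≤ Q * secondMomentOne f α β₂ θ a / (1 - β₁) :=
            div_le_div₀ (by positivity) h1 p₁ (b₁ a hαa).2
        _ = Q / (1 - β₁) * secondMomentOne f α β₂ θ a := by ring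
        _ ≤ _ := by
            refine mul_le_mul_of_nonneg_left ?_ (by positivity)
            exact le_div_self h2 (b₂ a hαa).1 (b₂ a hαa).2.2)
    (div_le_div₀ hK.le (le_of_abs_le (hc.secondMomentOne_le a ma)) p₂ (b₂ a hαa).2.1)
    (by positivity)
    ((norm_sq_momentOne_div_sub_le hβ₁ hβ₁' hα hδ hK hc hg ha hab hb hαa).trans
      (by gcongr; linarith))
    ((secondMomentOne_div_sub_le hβ₂ hβ₂' hα hδ hK hc hg ha hab hb hαa).trans
      (by gcongr; linarith))
  -- Moving the bias correction of `ε(t)` into the moments leaves a constant `ε` in the denominator,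
  -- and `1/(2λ₁)` becomes the factor `α`.
  have e : ∀ t, α ≤ t → effScalar f α β₁ β₂ ε θ t / (2 * rate α β₁) *
      ‖momentOne f α β₁ θ t‖ ^ 2 = α / (2 * (1 - β₁)) *
        (‖momentOne f α β₁ θ t‖ ^ 2 / (1 - β₁ ^ (t / α)) /
          (√(secondMomentOne f α β₂ θ t / (1 - β₂ ^ (t / α))) + ε)) := fun t ht => by
    rw [effScalar, effective_scalar_eq hβ₂ hβ₂' hα ht, rate]
    field_simp
  rw [e a hαa, e b (hαa.trans hab), ← mul_sub]
  calc _ ≤ α / (2 * (1 - β₁)) * (N * (b - a)) := by gcongr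
    _ = _ := by ring

theorem gap_le_lyapunov (hβ₁ : 0 ≤ β₁) (hβ₁' : β₁ < 1) (hε : 0 < ε) (hα : 0 < α) {t : ℝ}
    (ht : α ≤ t) : gap f x₀ (θ t) ≤ lyapunov f x₀ α β₁ β₂ ε θ t := by
  have h1 : 0 ≤ effScalar f α β₁ β₂ ε θ t := effective_scalar_nonneg hβ₁ hβ₁' hε hα ht
  have h2 := rate_pos hα hβ₁'
  rw [lyapunov]
  have : 0 ≤ effScalar f α β₁ β₂ ε θ t / (2 * rate α β₁) * ‖momentOne f α β₁ θ t‖ ^ 2 := by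
    positivity
  linarith

/-- Makes the constant `C''` of the strongly convex case independent of `α` and of the trajectory.
-/
theorem lyapunov_le (hβ₁ : 0 ≤ β₁) (hβ₁' : β₁ < 1) (hβ₂ : 0 ≤ β₂) (hβ₂' : β₂ < 1) (hε : 0 < ε)
    (hα : 0 < α) (hαδ : α ≤ δ) (hδT : δ ≤ T) (hc : IsControlled f α β₁ β₂ δ T K θ)
    (hθ : θ δ ∈ sublevel f x₀) :
    lyapunov f x₀ α β₁ β₂ ε θ δ ≤
      gap f x₀ x₀ + 1 / (ε * (1 - β₁)) * (δ / (2 * (1 - β₁))) * K ^ 2 := by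
  have p₁ : 0 < 1 - β₁ := by linarith
  have h1 : effScalar f α β₁ β₂ ε θ δ ≤ 1 / (ε * (1 - β₁)) :=
    effective_scalar_le hβ₁ hβ₁' hβ₂ hβ₂' hε hα hαδ
  have h2 : effScalar f α β₁ β₂ ε θ δ / (2 * rate α β₁) =
      effScalar f α β₁ β₂ ε θ δ * (α / (2 * (1 - β₁))) := by
    rw [rate]
    field_simp
  have hδ : 0 < δ := hα.trans_le hαδ
  have h3 := hc.momentOne_le δ ⟨hα.le.trans hαδ, hδT⟩
  rw [lyapunov, h2]
  gcongr
  exact gap_le hθ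

theorem alpha_le_rho : α ≤ rho α β₁ β₂ := le_max_left _ _

/-- Along `θ` the residual decreases, between `δ` and `T - α`, at rate `κ ‖∇f‖²` up to an error
`C α²`. -/
def IsDissipative (f : EuclideanSpace ℝ (Fin d) → ℝ) (x₀ : EuclideanSpace ℝ (Fin d))
    (α δ T κ C : ℝ) (θ : ℝ → EuclideanSpace ℝ (Fin d)) : Prop :=
  ∃ Φ' : ℝ → ℝ, ∀ t ∈ Icc δ (T - α), HasDerivAt (fun t => gap f x₀ (θ t)) (Φ' t) t ∧
    Φ' t ≤ -κ * ‖gradient f (θ t)‖ ^ 2 + C * α ^ 2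

theorem exists_isDissipative (hf : ContDiff ℝ 4 f)
    (hβ₁ : 0 ≤ β₁) (hβ₁' : β₁ < 1) (hβ₂ : 0 ≤ β₂) (hβ₂' : β₂ < 1) (hε : 0 < ε) (hδ : 0 < δ)
    (CT : ℝ) (hK : 0 < K) :
    ∃ κ > 0, ∃ C > 0, ∀ α, 0 < α → α < δ → ∀ θ : ℝ → EuclideanSpace ℝ (Fin d),
      IsAdmissible f x₀ β₁ β₂ ε δ T CT α θ → IsControlled f α β₁ β₂ δ T K θ →
      IsDissipative f x₀ α δ T κ C θ := by
  obtain ⟨κ, hκ, C, hC, h⟩ := exists_inner_gradient_le (f := f) (x₀ := x₀) (T := T)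
    hβ₁ hβ₁' hβ₂ hβ₂' hε hδ CT hK
  refine ⟨κ, hκ, C, hC, fun α hα hαδ θ hθ hc => ⟨fun t =>
    inner ℝ (gradient f (θ t)) (derivWithin θ (Icc 0 T) t), fun t ht =>
      ⟨hc.hasDerivAt_gap (hf.differentiable (by norm_num)) ?_, h α hα hαδ θ hθ hc t ht⟩⟩⟩
  exact ⟨hδ.trans_le ht.1, by linarith [ht.2]⟩

/-- The potential part of the dissipation estimate, in terms of the first moment. -/
theorem IsDissipative.gap_sub_le {κ C : ℝ} (h : IsDissipative f x₀ α δ T κ C θ)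
    (hc : IsControlled f α β₁ β₂ δ T K θ) (hκ : 0 < κ)
    (hg : ContinuousOn (fun t => gradient f (θ t)) (Icc 0 T)) (hα : 0 < α) (hδ : 0 < δ)
    (hδT : δ ≤ T - α) :
    gap f x₀ (θ (T - α)) - gap f x₀ (θ δ) ≤
      -(κ / 2) * (∫ t in δ..(T - α), ‖momentOne f α β₁ θ t‖ ^ 2) +
        (κ * K ^ 2 + C) * α ^ 2 * (T - α - δ) := by
  obtain ⟨Φ', h⟩ := h
  have hsub : Icc δ (T - α) ⊆ Icc 0 T := Icc_subset_Icc hδ.le (by linarith)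
  have cM : ContinuousOn (fun t => ‖momentOne f α β₁ θ t‖ ^ 2) (Icc δ (T - α)) :=
    ((continuousOn_causalConv_kernelOne hg (by linarith)).mono hsub).norm.pow 2
  have iM : IntervalIntegrable (fun t => ‖momentOne f α β₁ θ t‖ ^ 2) volume δ (T - α) := by
    apply ContinuousOn.intervalIntegrable
    rwa [uIcc_of_le hδT]
  refine (intervalIntegral.sub_le_integral_of_hasDeriv_right_of_le
    (g := fun t => gap f x₀ (θ t)) (g' := Φ')
    (φ := fun t => -(κ / 2) * ‖momentOne f α β₁ θ t‖ ^ 2 + (κ * K ^ 2 + C) * α ^ 2) hδT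
    (fun t ht => (h t ht).1.continuousAt.continuousWithinAt)
    (fun t ht => (h t (Ioo_subset_Icc_self ht)).1.hasDerivWithinAt)
    (((continuousOn_const.mul cM).add continuousOn_const).integrableOn_compact isCompact_Icc)
    (fun t ht => ?_)).trans_eq ?_
  · have mt := Ioo_subset_Icc_self ht
    refine (h t mt).2.trans ?_
    have h1 := hc.momentOne_sub t ⟨mt.1, by linarith [mt.2]⟩
    have h2 : ‖momentOne f α β₁ θ t‖ ≤ ‖gradient f (θ t)‖ + K * α :=
      (norm_le_insert' _ _).trans (by gcongr)
    have h3 : ‖momentOne f α β₁ θ t‖ ^ 2 ≤ 2 * ‖gradient f (θ t)‖ ^ 2 + 2 * (K * α) ^ 2 := by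
      have h4 : ‖momentOne f α β₁ θ t‖ ^ 2 ≤ (‖gradient f (θ t)‖ + K * α) ^ 2 := by gcongr
      have h5 := sq_nonneg (‖gradient f (θ t)‖ - K * α)
      linarith
    have h6 := mul_le_mul_of_nonneg_left h3 (by positivity : 0 ≤ κ / 2)
    linarith
  · rw [intervalIntegral.integral_add (iM.const_mul _) (by simp),
      intervalIntegral.integral_const_mul, intervalIntegral.integral_const, smul_eq_mul]
    ring

/-- Exponential decay of the residual under the Polyak-Łojasiewicz inequality. -/
theorem IsDissipative.gap_le_of_PLInequality {κ C μ : ℝ} (h : IsDissipative f x₀ α δ T κ C θ)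
    (hPL : PLInequality f x₀ μ) (hκ : 0 < κ) (hμ : 0 < μ) (hC : 0 < C)
    (hθ : ∀ t ∈ Icc δ (T - α), θ t ∈ sublevel f x₀) {t : ℝ} (ht : t ∈ Icc δ (T - α)) :
    gap f x₀ (θ t) ≤ gap f x₀ (θ δ) * Real.exp (-(2 * κ * μ) * (t - δ)) +
      C / (2 * κ * μ) * α ^ 2 := by
  obtain ⟨Φ', h⟩ := h
  refine (le_exp_add_of_deriv_le (Φ := fun t => gap f x₀ (θ t)) (Φ' := Φ') (ω := 2 * κ * μ)
    (E := C * α ^ 2) (by positivity) (by positivity) (fun t ht => (h t ht).1) (fun t ht => ?_)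
    ht).trans_eq (by ring)
  have h1 := mul_le_mul_of_nonneg_left (hPL (θ t) (hθ t ht)) (by positivity : 0 ≤ 2 * κ)
  have h2 := (h t ht).2
  linarith

/-- Decay of the residual under a global Kurdyka-Łojasiewicz inequality. -/
theorem IsDissipative.gap_le_klRate {κ C c σ : ℝ} (h : IsDissipative f x₀ α δ T κ C θ)
    (hKL : ∀ x ∈ sublevel f x₀, c * gap f x₀ x ^ σ ≤ ‖gradient f x‖) (hκ : 0 < κ) (hc : 0 < c)
    (hC : 0 < C) (hσ : 0 < σ) (hα : 0 < α) (hα1 : α ≤ 1)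
    (hgap : ∀ x ∈ sublevel f x₀, 0 ≤ gap f x₀ x)
    (hθ : ∀ t ∈ Icc δ (T - α), θ t ∈ sublevel f x₀) {t : ℝ} (ht : t ∈ Icc δ (T - α)) :
    gap f x₀ (θ t) ≤ klRate σ (κ * c ^ 2 / 2) (gap f x₀ (θ δ)) (t - δ) +
      (C / (κ * c ^ 2 / 2)) ^ (1 / (2 * σ)) * α ^ (1 / (2 * σ)) := by
  obtain ⟨Φ', h⟩ := h
  have hk : 0 < κ * c ^ 2 / 2 := by positivity
  refine le_klRate_add_of_deriv_le (Φ := fun t => gap f x₀ (θ t)) (Φ' := Φ') (E := C * α ^ 2)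
    hσ hk (by positivity) ?_ (fun t ht => hgap _ (hθ t ht)) (fun t ht => (h t ht).1)
    (fun t ht => ?_) ht
  -- The level `r` is chosen with `k r^{2σ} = Cα`, which dominates the forcing `Cα²` since `α ≤ 1`.
  · rw [← Real.mul_rpow (by positivity) hα.le, ← Real.rpow_mul (by positivity),
      one_div_mul_cancel (by positivity), Real.rpow_one, ← mul_assoc, mul_div_cancel₀ _ hk.ne']
    nlinarith [mul_le_mul_of_nonneg_left hα1 (by positivity : 0 ≤ C * α)]
  · have h1 := hgap _ (hθ t ht)
    have h2 : c ^ 2 * gap f x₀ (θ t) ^ (2 * σ) ≤ ‖gradient f (θ t)‖ ^ 2 := by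
      have h3 := pow_le_pow_left₀ (by positivity) (hKL (θ t) (hθ t ht)) 2
      rwa [mul_pow, ← Real.rpow_mul_natCast h1, mul_comm σ] at h3
    have h3 := mul_le_mul_of_nonneg_left h2 hκ.le
    have h4 := (h t ht).2
    linarith

/-- Convergence of the iterates to the minimizer in the strongly convex case. -/
theorem norm_sub_le_of_gap_le {μ V C e r : ℝ} (hf : Continuous f)
    (hS : IsCompact (sublevel f x₀)) (hμ : 0 < μ) (h : StrongConvexOn (sublevel f x₀) μ f)
    {z : EuclideanSpace ℝ (Fin d)} (hz : z ∈ sublevel f x₀) (hmin : IsMinOn f (sublevel f x₀) z)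
    {x : EuclideanSpace ℝ (Fin d)} (hx : x ∈ sublevel f x₀) (hV : 0 ≤ V) (hC : 0 ≤ C)
    (he : 0 ≤ e) (hr : 0 ≤ r) (hgap : gap f x₀ x ≤ V * e ^ 2 + C * r ^ 2) :
    ‖x - z‖ ≤ √(4 * V / μ) * e + √(4 * C / μ) * r := by
  have h1 := norm_sq_sub_le_of_strongConvexOn hf hS h hz hmin hx
  refine le_of_sq_le_sq ?_ (by positivity)
  have h2 := Real.sq_sqrt (by positivity : 0 ≤ 4 * V / μ)
  have h3 := Real.sq_sqrt (by positivity : 0 ≤ 4 * C / μ)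
  have h4 : 0 ≤ √(4 * V / μ) * e * (√(4 * C / μ) * r) := by positivity
  have h5 : ‖x - z‖ ^ 2 ≤ 4 * V / μ * e ^ 2 + 4 * C / μ * r ^ 2 := by
    calc ‖x - z‖ ^ 2 = 4 / μ * (μ / 4 * ‖x - z‖ ^ 2) := by field_simp
      _ ≤ 4 / μ * (V * e ^ 2 + C * r ^ 2) := by
          gcongr
          exact h1.trans hgap
      _ = _ := by ring
  calc _ ≤ 4 * V / μ * e ^ 2 + 4 * C / μ * r ^ 2 := h5
    _ = (√(4 * V / μ) * e) ^ 2 + (√(4 * C / μ) * r) ^ 2 := by rw [mul_pow, mul_pow, h2, h3]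
    _ ≤ _ := by nlinarith

end

end InertialAdam

end

/-! ### The main theorem. -/

theorem mainTheorem1 (d : ℕ) (f : EuclideanSpace ℝ (Fin d) → ℝ)
    (x₀ : EuclideanSpace ℝ (Fin d)) (β₁ β₂ ε δ T CT : ℝ)
    (hf : ContDiff ℝ 4 f) (hS : IsCompact (InertialAdam.sublevel f x₀))
    (hβ₁ : 0 ≤ β₁) (hβ₁' : β₁ < 1) (hβ₂ : 0 ≤ β₂) (hβ₂' : β₂ < 1) (hβ : β₁ ≤ √β₂)
    (hε : 0 < ε) (hδ : 0 < δ) (hδT : δ < T) :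
    ∃ α₀ > 0, ∃ c₀ > 0, ∃ C₀ > 0,
      -- basic dissipation and averaged moment control
      (∀ α, 0 < α → α ≤ α₀ → α < δ → ∀ θ : ℝ → EuclideanSpace ℝ (Fin d),
        InertialAdam.IsAdmissible f x₀ β₁ β₂ ε δ T CT α θ →
        (δ ≤ T - α →
          InertialAdam.lyapunov f x₀ α β₁ β₂ ε θ (T - α) -
              InertialAdam.lyapunov f x₀ α β₁ β₂ ε θ δ ≤
            -c₀ * (∫ t in δ..(T - α), ‖InertialAdam.momentOne f α β₁ θ t‖ ^ 2) +
              C₀ * InertialAdam.rho α β₁ β₂ * (T - α - δ)) ∧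
        (δ < T - α →
          1 / (T - α - δ) * (∫ t in δ..(T - α), ‖InertialAdam.momentOne f α β₁ θ t‖ ^ 2) ≤
            InertialAdam.lyapunov f x₀ α β₁ β₂ ε θ δ / (c₀ * (T - α - δ)) +
              C₀ / c₀ * InertialAdam.rho α β₁ β₂)) ∧
      -- PL case, including strong convexity
      (∀ μPL > 0, InertialAdam.PLInequality f x₀ μPL →
        ∃ ω > 0, ∃ C > 0,
          (∀ α, 0 < α → α ≤ α₀ → α < δ → ∀ θ : ℝ → EuclideanSpace ℝ (Fin d),
            InertialAdam.IsAdmissible f x₀ β₁ β₂ ε δ T CT α θ →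
            ∀ t ∈ Set.Icc δ (T - α),
              InertialAdam.gap f x₀ (θ t) ≤
                InertialAdam.lyapunov f x₀ α β₁ β₂ ε θ δ * Real.exp (-ω * (t - δ)) +
                  C * InertialAdam.rho α β₁ β₂ ^ 2) ∧
          (∀ μ > 0, StrongConvexOn (InertialAdam.sublevel f x₀) μ f →
            ∀ θs ∈ InertialAdam.sublevel f x₀, IsMinOn f (InertialAdam.sublevel f x₀) θs →
              ∃ C' > 0, ∃ C'' > 0,
                ∀ α, 0 < α → α ≤ α₀ → α < δ → ∀ θ : ℝ → EuclideanSpace ℝ (Fin d),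
                  InertialAdam.IsAdmissible f x₀ β₁ β₂ ε δ T CT α θ →
                  ∀ t ∈ Set.Icc δ (T - α),
                    ‖θ t - θs‖ ≤ C'' * Real.exp (-ω * (t - δ) / 2) +
                      C' * InertialAdam.rho α β₁ β₂)) ∧
      -- general KL case
      (∀ σ, 0 < σ → σ < 1 → InertialAdam.KLInequality f x₀ σ →
        ∃ k > 0, ∃ C > 0,
          ∀ α, 0 < α → α ≤ α₀ → α < δ → ∀ θ : ℝ → EuclideanSpace ℝ (Fin d),
            InertialAdam.IsAdmissible f x₀ β₁ β₂ ε δ T CT α θ →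
            ∀ t ∈ Set.Icc δ (T - α),
              InertialAdam.gap f x₀ (θ t) ≤
                  InertialAdam.klRate σ k (InertialAdam.gap f x₀ (θ δ)) (t - δ) +
                    C * InertialAdam.rho α β₁ β₂ ^ (1 / (2 * σ)) ∧
              InertialAdam.klRate σ k (InertialAdam.gap f x₀ (θ δ)) (t - δ) ≤
                InertialAdam.klRate σ k (InertialAdam.gap f x₀ x₀) (t - δ)) := by
  obtain ⟨K, hK, hcontrol⟩ := InertialAdam.exists_isControlled hf hS hβ₁ hβ₁' hβ₂ hβ₂' hε hδ CT hδT
  obtain ⟨κ, hκ, C, hC, hdiss⟩ := InertialAdam.exists_isDissipative (T := T) (x₀ := x₀)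
    hf hβ₁ hβ₁' hβ₂ hβ₂' hε hδ CT hK
  obtain ⟨N, hN, hkin⟩ := InertialAdam.exists_kinetic_sub_le (f := f) (T := T)
    hβ₁ hβ₁' hβ₂ hβ₂' hβ hε hδ hK
  have hcf := hf.continuous
  have p₁ : 0 < 1 - β₁ := by linarith
  have hgap : ∀ x ∈ InertialAdam.sublevel f x₀, 0 ≤ InertialAdam.gap f x₀ x := fun x hx =>
    InertialAdam.gap_nonneg hcf hS hx
  have hmem : ∀ {α θ}, 0 < α → InertialAdam.IsAdmissible f x₀ β₁ β₂ ε δ T CT α θ →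
      ∀ t ∈ Set.Icc δ (T - α), θ t ∈ InertialAdam.sublevel f x₀ := fun hα hθ t ht =>
    hθ.mem_sublevel t ⟨by linarith [ht.1], by linarith [ht.2]⟩
  have hρ : ∀ α, α ≤ InertialAdam.rho α β₁ β₂ := fun α => InertialAdam.alpha_le_rho
  have hdissipation : ∀ α, 0 < α → α ≤ 1 → α < δ → ∀ θ : ℝ → EuclideanSpace ℝ (Fin d),
      InertialAdam.IsAdmissible f x₀ β₁ β₂ ε δ T CT α θ → δ ≤ T - α →
      InertialAdam.lyapunov f x₀ α β₁ β₂ ε θ (T - α) - InertialAdam.lyapunov f x₀ α β₁ β₂ ε θ δ ≤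
        -(κ / 2) * (∫ t in δ..(T - α), ‖InertialAdam.momentOne f α β₁ θ t‖ ^ 2) +
          (κ * K ^ 2 + C + N) * InertialAdam.rho α β₁ β₂ * (T - α - δ) := by
    intro α hα hα1 hαδ θ hθ hle
    have hc := hcontrol α hα hαδ hle θ hθ
    have hg : ContinuousOn (fun t => gradient f (θ t)) (Set.Icc 0 T) :=
      (InertialAdam.contDiff_gradient hf).continuous.comp_continuousOn hc.continuousOn
    have h1 := (hdiss α hα hαδ θ hθ hc).gap_sub_le hc hκ hg hα hδ hle
    have h2 := hkin α hα θ hc hg δ (T - α) le_rfl hle (by linarith) hαδ.le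
    have h3 : 0 ≤ T - α - δ := by linarith
    have h4 : (κ * K ^ 2 + C) * α ^ 2 * (T - α - δ) + N * α * (T - α - δ) ≤
        (κ * K ^ 2 + C + N) * InertialAdam.rho α β₁ β₂ * (T - α - δ) := by
      -- Here `α ≤ 1` enters, which is why `α₀ = 1` suffices: `α² ≤ α ≤ ρ`.
      have h5 : α ^ 2 ≤ InertialAdam.rho α β₁ β₂ := by
        have := hρ α
        nlinarith
      calc _ ≤ (κ * K ^ 2 + C) * InertialAdam.rho α β₁ β₂ * (T - α - δ) +
            N * InertialAdam.rho α β₁ β₂ * (T - α - δ) := by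
              gcongr
              exact hρ α
        _ = _ := by ring
    rw [InertialAdam.lyapunov, InertialAdam.lyapunov]
    linarith
  refine ⟨1, one_pos, κ / 2, by positivity, κ * K ^ 2 + C + N, by positivity, ?_, ?_, ?_⟩
  · refine fun α hα hα1 hαδ θ hθ => ⟨hdissipation α hα hα1 hαδ θ hθ, fun hlt => ?_⟩
    have h1 := hdissipation α hα hα1 hαδ θ hθ hlt.le
    -- Discarding the nonnegative final value of `V` turns the dissipation estimate into the time
    -- average.
    have h2 : 0 ≤ InertialAdam.lyapunov f x₀ α β₁ β₂ ε θ (T - α) :=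
      (hgap _ (hmem hα hθ _ ⟨hlt.le, le_rfl⟩)).trans
        (InertialAdam.gap_le_lyapunov hβ₁ hβ₁' hε hα (by linarith))
    have h3 : 0 < T - α - δ := by linarith
    set I := ∫ t in δ..(T - α), ‖InertialAdam.momentOne f α β₁ θ t‖ ^ 2
    set V := InertialAdam.lyapunov f x₀ α β₁ β₂ ε θ δ
    set s := T - α - δ
    have h4 : κ / 2 * I ≤ V + (κ * K ^ 2 + C + N) * InertialAdam.rho α β₁ β₂ * s := by linarith
    calc 1 / s * I = κ / 2 * I / (κ / 2 * s) := by field_simp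
      _ ≤ (V + (κ * K ^ 2 + C + N) * InertialAdam.rho α β₁ β₂ * s) / (κ / 2 * s) := by gcongr
      _ = _ := by field_simp
  · intro μ hμ hPL
    have hdecay : ∀ α, 0 < α → α ≤ 1 → α < δ → ∀ θ : ℝ → EuclideanSpace ℝ (Fin d),
        InertialAdam.IsAdmissible f x₀ β₁ β₂ ε δ T CT α θ → ∀ t ∈ Set.Icc δ (T - α),
        InertialAdam.gap f x₀ (θ t) ≤
          InertialAdam.lyapunov f x₀ α β₁ β₂ ε θ δ * Real.exp (-(2 * κ * μ) * (t - δ)) +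
            C / (2 * κ * μ) * InertialAdam.rho α β₁ β₂ ^ 2 := by
      intro α hα hα1 hαδ θ hθ t ht
      have hc := hcontrol α hα hαδ (ht.1.trans ht.2) θ hθ
      refine ((hdiss α hα hαδ θ hθ hc).gap_le_of_PLInequality hPL hκ hμ hC (hmem hα hθ) ht).trans ?_
      gcongr
      · exact InertialAdam.gap_le_lyapunov hβ₁ hβ₁' hε hα hαδ.le
      · exact hρ α
    refine ⟨2 * κ * μ, by positivity, C / (2 * κ * μ), by positivity, hdecay,
      fun m hm hconv z hz hmin => ?_⟩
    have hg0 := hgap x₀ (le_refl (f x₀))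
    set V := InertialAdam.gap f x₀ x₀ + 1 / (ε * (1 - β₁)) * (δ / (2 * (1 - β₁))) * K ^ 2 with hV
    have hV0 : 0 < V := by positivity
    refine ⟨√(4 * (C / (2 * κ * μ)) / m), Real.sqrt_pos.2 (by positivity), √(4 * V / m),
      Real.sqrt_pos.2 (by positivity), fun α hα hα1 hαδ θ hθ t ht => ?_⟩
    have hle := ht.1.trans ht.2
    have hc := hcontrol α hα hαδ hle θ hθ
    refine InertialAdam.norm_sub_le_of_gap_le hcf hS hm hconv hz hmin (hmem hα hθ t ht) hV0.le
      (by positivity) (Real.exp_pos _).le (hα.le.trans (hρ α))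
      ((hdecay α hα hα1 hαδ θ hθ t ht).trans ?_)
    have he : Real.exp (-(2 * κ * μ) * (t - δ) / 2) ^ 2 = Real.exp (-(2 * κ * μ) * (t - δ)) := by
      rw [← Real.exp_nat_mul]
      congr 1
      push_cast
      ring
    rw [he]
    gcongr
    exact InertialAdam.lyapunov_le hβ₁ hβ₁' hβ₂ hβ₂' hε hα hαδ.le hδT.le hc
      (hmem hα hθ δ ⟨le_rfl, hle⟩)
  · intro σ hσ _ hKL
    obtain ⟨c, hc0, hglobal⟩ := hKL.exists_global hf hS hσ
    refine ⟨κ * c ^ 2 / 2, by positivity, (C / (κ * c ^ 2 / 2)) ^ (1 / (2 * σ)), by positivity,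
      fun α hα hα1 hαδ θ hθ t ht => ?_⟩
    have hle := ht.1.trans ht.2
    have hc := hcontrol α hα hαδ hle θ hθ
    have mδ := hmem hα hθ δ ⟨le_rfl, hle⟩
    refine ⟨?_, InertialAdam.klRate_mono (by positivity) (hgap _ mδ) (InertialAdam.gap_le mδ)
      (sub_nonneg.2 ht.1)⟩
    refine ((hdiss α hα hαδ θ hθ hc).gap_le_klRate hglobal hκ hc0 hC hσ hα hα1 hgap (hmem hα hθ)
      ht).trans ?_
    gcongr
    exact hρ α
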